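/- **Setting.** Fix $\beta\ge 1$. *Constraints* are Boolean combinations of atoms $t<t'$, $t=t'$, $t=\mathfrak d$, $t<\mathfrak d$, $t>\mathfrak d$, with $\mathfrak d\in\mathbb Z$ and $t,t'$ among the terms $x_1,\dots,x_\beta,x_1',\dots,x_\beta'$; write $\mathbb Z\models\Theta(z,z')$ if $\Theta$ holds for $x=z$, $x'=z'$ with $z,z'\in\mathbb Z^\beta$. The *size* of a constraint is its number of symbols, with integers (and indices of variables) encoded in binary. Given $\mathfrak d_1<\dots<\mathfrak d_\alpha$ in $\mathbb Z$ ($\alpha\ge 1$) and $z_1,\dots,z_{2\beta}=x_1,\dots,x_\beta,x_1',\dots,x_\beta'$, a *type* is a constraint $\bigwedge_i\Theta_i\wedge\bigwedge_{i<j}z_i\sim_{i,j}z_j$, where each $\Theta_i$ is $z_i<\mathfrak d_1$, or $z_i>\mathfrak d_\alpha$, or $z_i=\mathfrak d$ for some integer $\mathfrak d\in[\mathfrak d_1,\mathfrak d_\alpha]$, and each $\sim_{i,j}$ is $<$, $=$ or $>$. Let $\mathrm{SatTypes}(\beta)$ be the set of satisfiable types. A *Büchi* (resp. *Rabin*) *word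 constraint automaton* consists of a finite set $Q$ of locations, a finite alphabet $\Sigma$, the number $\beta$, a set $Q_{in}\subseteq Q$ of initial locations, a finite set $\delta$ of transitions $(q,a,\Theta,q')$ with $q,q'\in Q$, $a\in\Sigma$ and $\Theta$ a constraint, and a set $F\subseteq Q$ (resp. a finite set $\mathcal F$ of Rabin pairs $(L,U)$ with $L,U\subseteq Q$). An initialized run on a word $(a_0,z_0)(a_1,z_1)\cdots\in(\Sigma\times\mathbb Z^\beta)^\omega$ is a sequence of transitions $(q_n,a_n,\Theta_n,q_{n+1})\in\delta$, $n\ge 0$, with $q_0\in Q_{in}$ and $\mathbb Z\models\Theta_n(z_n,z_{n+1})$ for all $n$. It is accepting if the set $I$ of locations $q$ with $q_n=q$ for infinitely many $n$ satisfies $I\cap F\ne\emptyset$ (resp. $I\cap L\neq\emptyset$ and $I\cap U=\emptyset$ for some $(L,U)\in\mathcal F$). $\mathrm L(\mathbb A)$ is the set of words with an initialized accepting run. The automaton is *deterministic* if for all $q$, $a$, $z$, $z'$ there is at most one transition $(q,a,\Theta,q')\in\delta$ with $\mathbb Z\models\Theta(z,z')$. **Theorem.** There are absolute constants $c,C\in\mathbb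 N$ such that the following holds. Let $\mathbb A=(Q,\Sigma,\beta,Q_{in},\delta,F)$ be a Büchi word constraint automaton, and let $\mathfrak d_1<\dots<\mathfrak d_\alpha$ ($\alpha\ge1$) be integers among which are all the constants occurring in $\mathbb A$. Then there is a deterministic Rabin word constraint automaton $\mathbb A'=(Q',\Sigma,\beta,Q'_{in},\delta',\mathcal F)$ with exactly one initial location such that $\mathrm L(\mathbb A')=\mathrm L(\mathbb A)$ and: 1. $|Q'|\le 2^{c\,|Q|\log_2(|Q|+1)}=(|Q|+1)^{c|Q|}$, and $\mathcal F$ has at most $2|Q|$ Rabin pairs. 2. Every constraint in a transition of $\mathbb A'$ belongs to $\mathrm{SatTypes}(\beta)$ and has size at most $C\cdot\bigl(\beta+\max(\lceil\log_2|\mathfrak d_1|\rceil,\lceil\log_2|\mathfrak d_\alpha|\rceil)\bigr)^3$ (with $\log_2 0$ read as $0$), and $$|\delta'|\le |Q'|^2\cdot|\Sigma|\cdot\bigl((\mathfrak d_\alpha-\mathfrak d_1)+3\bigr)^{2\beta}\cdot 3^{2\beta^2}.$$ -/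

import Mathlib

/-! Word constraint automata over the integers: constraints, types, Büchi and Rabin acceptance. -/

namespace WordConstraint

/-- The terms over which the constraints of an automaton with `β` variables are built:
`cur i` is the variable `x_i` (current value), `nxt i` is `x'_i` (value at the next position). -/
inductive Term (β : ℕ) : Type
  | cur (i : Fin β) : Term β
  | nxt (i : Fin β) : Term β

/-- Constraints: Boolean combinations of the atoms `t < t'`, `t = t'`, `t = d`, and of the
comparisons `t < d`, `t > d` with a constant, which occur in types. -/
inductive Constraint (β : ℕ) : Type
  | tru : Constraint β
  | lt (s t : Term β) : Constraint β
  | eq (s t : Term β) : Constraint β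
  | eqConst (t : Term β) (d : ℤ) : Constraint β
  | ltConst (t : Term β) (d : ℤ) : Constraint β
  | gtConst (t : Term β) (d : ℤ) : Constraint β
  | neg (θ : Constraint β) : Constraint β
  | conj (θ₁ θ₂ : Constraint β) : Constraint β
  | disj (θ₁ θ₂ : Constraint β) : Constraint β

variable {β : ℕ}

/-- The value of a term when the current values are `z` and the next values are `z'`. -/
def Term.val (z z' : Fin β → ℤ) : Term β → ℤ
  | .cur i => z i
  | .nxt i => z' i

/-- `ℤ ⊨ Θ(z, z')`. -/
def Constraint.Holds (z z' : Fin β → ℤ) : Constraint β → Prop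
  | .tru => True
  | .lt s t => s.val z z' < t.val z z'
  | .eq s t => s.val z z' = t.val z z'
  | .eqConst t d => t.val z z' = d
  | .ltConst t d => t.val z z' < d
  | .gtConst t d => d < t.val z z'
  | .neg θ => ¬ θ.Holds z z'
  | .conj θ₁ θ₂ => θ₁.Holds z z' ∧ θ₂.Holds z z'
  | .disj θ₁ θ₂ => θ₁.Holds z z' ∨ θ₂.Holds z z'

def Constraint.Satisfiable (θ : Constraint β) : Prop :=
  ∃ z z' : Fin β → ℤ, θ.Holds z z'

/-- The constants occurring in a constraint. -/
def Constraint.consts : Constraint β → Finset ℤ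
  | .tru => ∅
  | .lt _ _ => ∅
  | .eq _ _ => ∅
  | .eqConst _ d => {d}
  | .ltConst _ d => {d}
  | .gtConst _ d => {d}
  | .neg θ => θ.consts
  | .conj θ₁ θ₂ => θ₁.consts ∪ θ₂.consts
  | .disj θ₁ θ₂ => θ₁.consts ∪ θ₂.consts

/-- Length of the binary encoding of an integer: its binary digits and its sign. -/
def intSize (d : ℤ) : ℕ := Nat.size d.natAbs + 1

/-- Size of a term: its symbols (`x'_i` abbreviates "next `x_i`"), together with the
binary encoding of the index of the variable. -/
def Term.size : Term β → ℕ
  | .cur i => 1 + Nat.size (i + 1)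
  | .nxt i => 2 + Nat.size (i + 1)

/-- Size of a constraint: the number of its symbols, with integers encoded in binary. -/
def Constraint.size : Constraint β → ℕ
  | .tru => 1
  | .lt s t => s.size + 1 + t.size
  | .eq s t => s.size + 1 + t.size
  | .eqConst t d => t.size + 1 + intSize d
  | .ltConst t d => t.size + 1 + intSize d
  | .gtConst t d => t.size + 1 + intSize d
  | .neg θ => 1 + θ.size
  | .conj θ₁ θ₂ => θ₁.size + 1 + θ₂.size
  | .disj θ₁ θ₂ => θ₁.size + 1 + θ₂.size

/-! ### Types -/

/-- Conjunction of a list of constraints. -/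
def conjList : List (Constraint β) → Constraint β
  | [] => .tru
  | [θ] => θ
  | θ :: θ' :: l => .conj θ (conjList (θ' :: l))

/-- The enumeration `z_1, …, z_{2β}` of the terms `x_1, …, x_β, x'_1, …, x'_β`. -/
def termAt (k : Fin (β + β)) : Term β :=
  Sum.elim Term.cur Term.nxt (finSumFinEquiv.symm k)

/-- How a type compares one term to the constants. -/
inductive ConstRel : Type
  | below : ConstRel
  | equal (d : ℤ) : ConstRel
  | above : ConstRel

/-- The conjunct `t < lo`, `t = d` or `t > hi`. -/
def ConstRel.toConstraint (lo hi : ℤ) (t : Term β) : ConstRel → Constraint β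
  | .below => .ltConst t lo
  | .equal d => .eqConst t d
  | .above => .gtConst t hi

/-- The conjunct `s < t`, `s = t` or `s > t`; the last one is written `t < s`. -/
def orderConstraint (s t : Term β) : Ordering → Constraint β
  | .lt => .lt s t
  | .eq => .eq s t
  | .gt => .lt t s

/-- The expression `(⋀ i, Θ_i) ∧ (⋀ i < j, z_i ∼_{i,j} z_j)`. -/
def typeConstraint (lo hi : ℤ) (cst : Fin (β + β) → ConstRel)
    (rel : Fin (β + β) → Fin (β + β) → Ordering) : Constraint β :=
  .conj
    (conjList ((List.finRange (β + β)).map fun i => (cst i).toConstraint lo hi (termAt i)))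
    (conjList ((((List.finRange (β + β)) ×ˢ (List.finRange (β + β))).filter
      fun p => p.1 < p.2).map fun p => orderConstraint (termAt p.1) (termAt p.2) (rel p.1 p.2)))

/-- `Θ` is a type over `x_1, …, x_β, x'_1, …, x'_β` with smallest constant `lo` and largest
constant `hi`. -/
def IsType (lo hi : ℤ) (θ : Constraint β) : Prop :=
  ∃ (cst : Fin (β + β) → ConstRel) (rel : Fin (β + β) → Fin (β + β) → Ordering),
    (∀ i d, cst i = .equal d → lo ≤ d ∧ d ≤ hi) ∧ θ = typeConstraint lo hi cst rel

/-- The set of satisfiable types. -/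
def SatTypes (β : ℕ) (lo hi : ℤ) : Set (Constraint β) :=
  {θ | IsType lo hi θ ∧ θ.Satisfiable}

/-! ### Automata -/

/-- A transition `(q, a, Θ, q')`. -/
structure Transition (Q A : Type*) (β : ℕ) where
  src : Q
  letter : A
  guard : Constraint β
  tgt : Q

/-- A word constraint automaton with `β` variables, without its acceptance condition. -/
structure Automaton (Q A : Type*) (β : ℕ) where
  init : Set Q
  trans : Finset (Transition Q A β)

/-- Büchi word constraint automata. -/
structure BuchiAutomaton (Q A : Type*) (β : ℕ) extends Automaton Q A β where
  acc : Set Q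

/-- Rabin word constraint automata; `pairs` consists of the Rabin pairs `(L, U)`. -/
structure RabinAutomaton (Q A : Type*) (β : ℕ) extends Automaton Q A β where
  pairs : Finset (Set Q × Set Q)

variable {Q A : Type*}

/-- The constants occurring in the automaton. -/
def Automaton.consts (M : Automaton Q A β) : Set ℤ :=
  {d | ∃ τ ∈ M.trans, d ∈ τ.guard.consts}

/-- For every location, letter and pair of valuations there is at most one transition from this
location, with this letter, whose constraint is satisfied by the two valuations. -/
def Automaton.Deterministic (M : Automaton Q A β) : Prop :=
  ∀ (q : Q) (a : A) (z z' : Fin β → ℤ), ∀ τ₁ ∈ M.trans, ∀ τ₂ ∈ M.trans,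
    τ₁.src = q → τ₁.letter = a → τ₁.guard.Holds z z' →
    τ₂.src = q → τ₂.letter = a → τ₂.guard.Holds z z' → τ₁ = τ₂

/-- `ρ` is an initialized run on the infinite data word `w`. -/
structure Automaton.IsInitRun (M : Automaton Q A β) (w : ℕ → A × (Fin β → ℤ))
    (ρ : ℕ → Transition Q A β) : Prop where
  init : (ρ 0).src ∈ M.init
  mem : ∀ n, ρ n ∈ M.trans
  letter : ∀ n, (ρ n).letter = (w n).1
  step : ∀ n, (ρ (n + 1)).src = (ρ n).tgt
  guard : ∀ n, (ρ n).guard.Holds (w n).2 (w (n + 1)).2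

/-- The locations that occur infinitely often as source locations along `ρ`. -/
def infLoc (ρ : ℕ → Transition Q A β) : Set Q :=
  {q | {n | (ρ n).src = q}.Infinite}

/-- `L(M)` for a Büchi automaton. -/
def BuchiAutomaton.lang (M : BuchiAutomaton Q A β) : Set (ℕ → A × (Fin β → ℤ)) :=
  {w | ∃ ρ, M.IsInitRun w ρ ∧ (infLoc ρ ∩ M.acc).Nonempty}

/-- `L(M)` for a Rabin automaton. -/
def RabinAutomaton.lang (M : RabinAutomaton Q A β) : Set (ℕ → A × (Fin β → ℤ)) :=
  {w | ∃ ρ, M.IsInitRun w ρ ∧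
    ∃ p ∈ M.pairs, (infLoc ρ ∩ p.1).Nonempty ∧ infLoc ρ ∩ p.2 = ∅}

end WordConstraint

/-! Two independent ideas combine. First, the data is removed: a pair of valuations satisfies
exactly one type over the constants between `lo` and `hi`, and this type decides every guard whose
constants lie in that range (`holds_iff_of_holds_typeOf`). A data word thus becomes a sequence of
relations `moves` on the finite set of locations, and acceptance by the Büchi automaton becomes the
existence of a path through these relations that meets the accepting set infinitely often
(`mem_lang_iff`).

Second, such sequences of relations are determinized by a Safra construction. Each reached state
carries a path, the list of birth stamps of the nodes from the root down to it; `[]` means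
unreached. Older stamps are larger, and lists are compared lexicographically, so the largest path
prefers old nodes and, among extensions of one node, the deeper ones. In a step a state inherits the
largest path of its predecessors, and accepting states open a child. A node that is no state's exact
path absorbs all its descendants; it is then good. A node that is good infinitely often yields an
accepting run by König's lemma (`exists_run_of_good`). Conversely, the paths along an accepting run
have an eventually constant prefix, of length the limit inferior of their lengths, and this prefix
is good infinitely often (`exists_good_of_run`).

Absolute stamps are unbounded, but a step depends only on their order, so they can be replaced by
ranks (`step_relabel`, `run_fst`). For each rank `i`, a Rabin pair demands infinitely many good
nodes of rank `i` and only finitely many losses of a stamp of rank at most `i`. A state's path is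
coded by a state at the parent node and one last stamp, which gives the bound `(n + 1) ^ (4 * n)`.
-/

namespace Safra

open Filter

/-! ### Lists of stamps, ordered lexicographically -/

/-- The largest element of a finite set of lists, and `[]` for the empty set. -/
noncomputable def best (S : Finset (List ℤ)) : List ℤ := S.max.unbotD []

theorem coe_best {S : Finset (List ℤ)} (h : S.Nonempty) : S.max = (best S : WithBot (List ℤ)) := by
  obtain ⟨m, hm⟩ := Finset.max_of_nonempty h
  simp [best, hm]

theorem le_best {S : Finset (List ℤ)} {l : List ℤ} (h : l ∈ S) : l ≤ best S := by
  have := Finset.le_max h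
  rw [coe_best ⟨l, h⟩] at this
  exact WithBot.coe_le_coe.1 this

theorem best_mem {S : Finset (List ℤ)} (h : S.Nonempty) : best S ∈ S :=
  Finset.mem_of_max (coe_best h)

theorem best_empty : best ∅ = [] := by simp [best]

theorem prefix_le {l m : List ℤ} (h : l <+: m) : l ≤ m := not_lt.1 (List.IsPrefix.le h)

theorem cons_le_cons_iff {a b : ℤ} {l m : List ℤ} :
    a :: l ≤ b :: m ↔ a < b ∨ a = b ∧ l ≤ m := by
  rw [← not_lt, ← not_lt (a := m)]
  exact List.cons_le_cons_iff

/-- The first difference decides the comparison; truncating at a common length keeps it or erases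
it, but never reverses it. -/
theorem take_le_take {l m : List ℤ} (h : l ≤ m) (k : ℕ) : l.take k ≤ m.take k := by
  induction k generalizing l m with
  | zero => simp
  | succ k ih =>
    cases l with
    | nil => exact prefix_le List.nil_prefix
    | cons a l =>
      cases m with
      | nil => exact absurd (h.antisymm (prefix_le List.nil_prefix)) (by simp)
      | cons b m =>
        rw [List.take_succ_cons, List.take_succ_cons]
        rw [cons_le_cons_iff] at h ⊢
        exact h.imp id fun h => ⟨h.1, ih h.2⟩

/-- A nondecreasing sequence of lists of constant length with nonpositive entries stabilizes. -/
theorem eventually_const_of_monotone (k : ℕ) (x : ℕ → List ℤ) (hk : ∀ t, (x t).length = k)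
    (hx : ∀ t, x t ≤ x (t + 1)) (h0 : ∀ t, ∀ s ∈ x t, s ≤ 0) :
    ∃ v, ∀ᶠ t in atTop, x t = v := by
  induction k generalizing x with
  | zero => exact ⟨[], Eventually.of_forall fun t => List.length_eq_zero_iff.1 (hk t)⟩
  | succ k ih =>
    choose a y hxy using fun t => List.exists_cons_of_length_eq_add_one (hk t)
    have ha : ∀ t, a t ≤ a (t + 1) := fun t => by
      have := hx t
      rw [hxy, hxy, cons_le_cons_iff] at this
      rcases this with h | h
      · exact h.le
      · exact h.1.le
    have ha0 : ∀ t, a t ≤ 0 := fun t => h0 t _ (by simp [hxy t])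
    -- The heads are nondecreasing and nonpositive, so their absolute values decrease in `ℕ` and
    -- stabilize; from then on the tails are nondecreasing.
    obtain ⟨N, hN⟩ : ∃ N, ∀ m, N ≤ m → a N = a m := by
      obtain ⟨N, hN⟩ := WellFoundedGT.monotone_chain_condition (α := ℕᵒᵈ)
        ⟨fun t => OrderDual.toDual (a t).natAbs, monotone_nat_of_le_succ fun t => by
          have h1 := ha t
          have h2 := ha0 t
          have h3 := ha0 (t + 1)
          rw [OrderDual.toDual_le_toDual]
          omega⟩
      refine ⟨N, fun m hm => ?_⟩
      have h1 : (a N).natAbs = (a m).natAbs := OrderDual.toDual.injective (hN m hm)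
      have h2 := ha0 N
      have h3 := ha0 m
      omega
    obtain ⟨v, hv⟩ := ih (fun t => y (t + N)) (fun t => by
        have := hk (t + N); rw [hxy] at this; simpa using this) (fun t => by
        have := hx (t + N)
        rw [hxy, hxy (t + N + 1), cons_le_cons_iff, ← hN (t + N) (by omega),
          ← hN (t + N + 1) (by omega)] at this
        have := this.resolve_left (lt_irrefl _)
        rw [show t + 1 + N = t + N + 1 by omega]
        exact this.2) (fun t s hs => h0 (t + N) s (by rw [hxy]; exact List.mem_cons_of_mem _ hs))
    refine ⟨a N :: v, ?_⟩
    rw [eventually_atTop] at hv ⊢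
    obtain ⟨T, hT⟩ := hv
    refine ⟨T + N, fun t ht => ?_⟩
    have := hT (t - N) (by omega)
    simp only [show t - N + N = t by omega] at this
    rw [hxy, this, ← hN t (by omega)]

/-- König's lemma for a sequence of nonempty sets with predecessor maps. -/
theorem exists_backward_path {V : Type*} [Finite V] (T : ℕ → Set V) (hT : ∀ t, (T t).Nonempty)
    (pr : ℕ → V → V) (h : ∀ t, ∀ q ∈ T (t + 1), pr t q ∈ T t) :
    ∃ ρ : ℕ → V, ∀ t, ρ t ∈ T t ∧ ρ t = pr t (ρ (t + 1)) := by
  let X : ℕ → Type _ := fun t => T t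
  let f : ∀ t, X (t + 1) → X t := fun t q => ⟨pr t q.1, h t _ q.2⟩
  -- The sets form an inverse system of nonempty finite sets under the predecessor maps; a section
  -- of it is the required path.
  let G := CategoryTheory.Functor.ofOpSequence (X := X) (fun t => CategoryTheory.ConcreteCategory.ofHom (C := Type _) ⟨f t⟩)
  have : ∀ j, Finite (G.obj j) := fun j => inferInstanceAs (Finite (T j.unop))
  have : ∀ j, Nonempty (G.obj j) := fun j => (hT j.unop).to_subtype
  obtain ⟨s, hs⟩ := nonempty_sections_of_finite_inverse_system G
  refine ⟨fun t => (s (Opposite.op t) : T t).1, fun t => ⟨(s (Opposite.op t) : T t).2, ?_⟩⟩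
  have := hs (CategoryTheory.homOfLE (Nat.le_add_right t 1)).op
  rw [CategoryTheory.Functor.ofOpSequence_map_homOfLE_succ] at this
  exact (congrArg Subtype.val this).symm

/-! ### The transition function of the determinization -/

variable {V : Type*} [Fintype V]

open Classical in
/-- The best path of a predecessor of `q`. -/
noncomputable def bestPred (L : V → V → Prop) (P : V → List ℤ) (q : V) : List ℤ :=
  best ((Finset.univ.filter fun p => L p q).image P)

open Classical in
/-- Every state inherits the best path of a predecessor; accepting states open a child with
stamp `f`. -/
noncomputable def raw (f : ℤ) (L : V → V → Prop) (F : Set V) (P : V → List ℤ) (q : V) : List ℤ :=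
  if q ∈ F ∧ bestPred L P q ≠ [] then bestPred L P q ++ [f] else bestPred L P q

/-- Length of the shortest nonempty prefix of `l` outside the range of `R`. -/
noncomputable def cut (R : V → List ℤ) (l : List ℤ) : ℕ :=
  sInf {k | 1 ≤ k ∧ (l.length ≤ k ∨ l.take k ∉ Set.range R)}

/-- Every path is cut at its first node that is not the path of any state. -/
noncomputable def trunc (R : V → List ℤ) (q : V) : List ℤ := (R q).take (cut R (R q))

noncomputable def step (f : ℤ) (L : V → V → Prop) (F : Set V) (P : V → List ℤ) : V → List ℤ :=
  trunc (raw f L F P)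

/-- All descendants of the node `v` are merged into it. -/
def IsGood (f : ℤ) (L : V → V → Prop) (F : Set V) (P : V → List ℤ) (v : List ℤ) : Prop :=
  v ≠ [] ∧ v ∈ Set.range (step f L F P) ∧ v ∉ Set.range (raw f L F P)

def PrefixClosed (P : V → List ℤ) : Prop :=
  ∀ q v, v ≠ [] → v <+: P q → v ∈ Set.range P

/-! ### Truncation of paths -/

omit [Fintype V] in
theorem cut_mem (R : V → List ℤ) (l : List ℤ) :
    cut R l ∈ {k | 1 ≤ k ∧ (l.length ≤ k ∨ l.take k ∉ Set.range R)} :=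
  -- The successor makes the witness positive also for `l = []`.
  Nat.sInf_mem ⟨l.length + 1, by omega, Or.inl (by omega)⟩

omit [Fintype V] in
theorem take_mem_range_of_lt_cut {R : V → List ℤ} {l : List ℤ} {k : ℕ} (h1 : 1 ≤ k)
    (hk : k < cut R l) : l.take k ∈ Set.range R := by
  have := Nat.notMem_of_lt_sInf hk
  by_contra h
  exact this ⟨h1, Or.inr h⟩

omit [Fintype V] in
theorem trunc_prefix (R : V → List ℤ) (q : V) : trunc R q <+: R q := List.take_prefix _ _

omit [Fintype V] in
theorem trunc_eq_nil_iff {R : V → List ℤ} {q : V} : trunc R q = [] ↔ R q = [] := by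
  have := (cut_mem R (R q)).1
  rw [trunc, List.take_eq_nil_iff]
  constructor
  · rintro (h | h)
    · omega
    · exact h
  · exact Or.inr

omit [Fintype V] in
-- A node that is no raw path forces the cut at or above it, so a truncated path through it must end
-- there.
theorem trunc_eq_of_not_mem {R : V → List ℤ} {q : V} {v : List ℤ} (hv : v ≠ [])
    (h : v <+: trunc R q) (hR : v ∉ Set.range R) : trunc R q = v := by
  have h1 : v <+: R q := h.trans (trunc_prefix R q)
  have h2 : cut R (R q) ≤ v.length := Nat.sInf_le
    ⟨List.length_pos_iff.2 hv, Or.inr (by rwa [← List.prefix_iff_eq_take.1 h1])⟩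
  exact (h.eq_of_length_le (by rw [trunc, List.length_take]; omega)).symm

omit [Fintype V] in
-- A proper prefix `v` of a truncated path lies before the cut, so it and all its nonempty prefixes
-- are raw paths. The state whose raw path is `v` is therefore not cut and keeps `v`.
theorem prefixClosed_trunc (R : V → List ℤ) : PrefixClosed (trunc R) := by
  intro q v hv h
  by_cases hq : trunc R q = v
  · exact ⟨q, hq⟩
  have hR : v ∈ Set.range R := by
    by_contra hR
    exact hq (trunc_eq_of_not_mem hv h hR)
  obtain ⟨q', hq'⟩ := hR
  refine ⟨q', ?_⟩
  have h1 : v <+: R q := h.trans (trunc_prefix R q)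
  have hlen : v.length ≤ cut R (R q) := h.length_le.trans (by rw [trunc, List.length_take]; omega)
  rw [trunc, hq', List.take_of_length_le]
  have := cut_mem R v
  rcases this.2 with h2 | h2
  · exact h2
  · by_contra h3
    push Not at h3
    refine h2 ?_
    have h4 : v.take (cut R v) = (R q).take (cut R v) := by
      obtain ⟨u, hu⟩ := h1
      rw [← hu, List.take_append_of_le_length h3.le]
    rw [h4]
    exact take_mem_range_of_lt_cut this.1 (by omega)

/-! ### Inherited paths -/

theorem le_bestPred {L : V → V → Prop} {P : V → List ℤ} {p q : V} (h : L p q) :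
    P p ≤ bestPred L P q :=
  le_best (Finset.mem_image_of_mem _ (by simpa using h))

theorem exists_bestPred {L : V → V → Prop} {P : V → List ℤ} {q : V} (h : bestPred L P q ≠ []) :
    ∃ p, L p q ∧ P p = bestPred L P q := by
  classical
  have hne : ((Finset.univ.filter fun p => L p q).image P).Nonempty := by
    by_contra hne
    rw [Finset.not_nonempty_iff_eq_empty] at hne
    refine h ?_
    unfold bestPred
    convert best_empty
  have := best_mem hne
  simp only [Finset.mem_image, Finset.mem_filter, Finset.mem_univ, true_and] at this
  obtain ⟨p, h1, h2⟩ := this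
  refine ⟨p, h1, h2.trans ?_⟩
  unfold bestPred
  congr!

theorem raw_of_mem {f : ℤ} {L : V → V → Prop} {F : Set V} {P : V → List ℤ} {q : V} (hq : q ∈ F)
    (h : bestPred L P q ≠ []) : raw f L F P q = bestPred L P q ++ [f] := by
  simp [raw, hq, h]

theorem raw_of_not_mem {f : ℤ} {L : V → V → Prop} {F : Set V} {P : V → List ℤ} {q : V}
    (hq : q ∉ F) : raw f L F P q = bestPred L P q := by
  simp [raw, hq]

theorem bestPred_prefix_raw (f : ℤ) (L : V → V → Prop) (F : Set V) (P : V → List ℤ) (q : V) :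
    bestPred L P q <+: raw f L F P q := by
  unfold raw; split
  · exact List.prefix_append _ _
  · exact List.prefix_rfl

theorem raw_prefix (f : ℤ) (L : V → V → Prop) (F : Set V) (P : V → List ℤ) (q : V) :
    raw f L F P q <+: bestPred L P q ++ [f] := by
  unfold raw; split
  · exact List.prefix_rfl
  · exact List.prefix_append _ _

theorem raw_eq_nil_iff {f : ℤ} {L : V → V → Prop} {F : Set V} {P : V → List ℤ} {q : V} :
    raw f L F P q = [] ↔ bestPred L P q = [] := by
  unfold raw; split
  · next h => simp [h.2]
  · rfl

theorem exists_pred {f : ℤ} {L : V → V → Prop} {F : Set V} {P : V → List ℤ} {q : V}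
    (h : raw f L F P q ≠ []) : ∃ p, L p q ∧ P p ≠ [] ∧ P p = bestPred L P q := by
  obtain ⟨p, h1, h2⟩ := exists_bestPred (L := L) (P := P) (q := q)
    (fun h' => h (raw_eq_nil_iff.2 h'))
  exact ⟨p, h1, fun h' => h (raw_eq_nil_iff.2 (h2 ▸ h')), h2⟩

/-- A prefix of a new path that avoids the fresh stamp is a prefix of the inherited path. -/
theorem prefix_bestPred {f : ℤ} {L : V → V → Prop} {F : Set V} {P : V → List ℤ} {q : V}
    {v : List ℤ} (hf : v.getLast? ≠ some f) (h : v <+: raw f L F P q) :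
    v <+: bestPred L P q := by
  rcases List.prefix_concat_iff.1 (h.trans (raw_prefix f L F P q)) with h | h
  · exact absurd (by simp [h]) hf
  · exact h

/-- Nodes without the fresh stamp are inherited. -/
theorem mem_range_of_mem_range_step {f : ℤ} {L : V → V → Prop} {F : Set V} {P : V → List ℤ}
    (hP : PrefixClosed P) {v : List ℤ} (hv : v ≠ []) (hf : v.getLast? ≠ some f)
    (h : v ∈ Set.range (step f L F P)) : v ∈ Set.range P := by
  obtain ⟨q, hq⟩ := h
  have h1 : v <+: raw f L F P q := hq ▸ trunc_prefix _ _
  have h2 := prefix_bestPred hf h1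
  obtain ⟨p, -, -, hp⟩ := exists_pred (f := f) (F := F) (L := L) (P := P) (q := q)
    (fun h => hv (by rw [h] at h1; exact List.prefix_nil.1 h1))
  exact hP p v hv (hp ▸ h2)

theorem mem_of_mem_step {f : ℤ} {L : V → V → Prop} {F : Set V} {P : V → List ℤ} {q : V} {s : ℤ}
    (h : s ∈ step f L F P q) : s = f ∨ ∃ p, s ∈ P p := by
  have h1 : s ∈ raw f L F P q := (trunc_prefix _ _).subset h
  obtain ⟨p, -, -, hp⟩ := exists_pred (List.ne_nil_of_mem h1)
  have h2 := (raw_prefix f L F P q).subset h1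
  rw [← hp, List.mem_append, List.mem_singleton] at h2
  exact h2.symm.imp id fun h => ⟨p, h⟩

/-- The number of nodes on a path is at most the number of states. -/
theorem length_le_card {P : V → List ℤ} (hP : PrefixClosed P) (q : V) :
    (P q).length ≤ Fintype.card V := by
  -- The nonempty prefixes have distinct lengths, hence are the paths of distinct states.
  have h : ∀ j : Fin (P q).length, ∃ p, P p = (P q).take (j + 1) := fun j =>
    hP q _ (by
      rw [Ne, List.take_eq_nil_iff]
      rintro (h | h)
      · omega
      · have := j.2; simp [h] at this) (List.take_prefix _ _)
  choose g hg using h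
  have := Fintype.card_le_of_injective g (fun i j hij => by
    have h1 := congrArg List.length ((hg i).symm.trans ((congrArg P hij).trans (hg j)))
    simp only [List.length_take] at h1
    have := i.2
    have := j.2
    exact Fin.ext (by omega))
  simpa using this

/-! ### Correctness with absolute time stamps -/

variable {V : Type*} [Fintype V]

/-- The paths at time `t` on the input `w`; the stamp `-(t + 1)` is given to nodes born in the
step from `t` to `t + 1`. -/
noncomputable def track (I F : Set V) (w : ℕ → V → V → Prop) : ℕ → V → List ℤ
  | 0 => open Classical in fun q => if q ∈ I then [0] else []
  | t + 1 => step (-((t : ℤ) + 1)) (w t) F (track I F w t)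

/-- The node `v` merges all its descendants in the step from `t` to `t + 1`. -/
def GoodAt (I F : Set V) (w : ℕ → V → V → Prop) (v : List ℤ) (t : ℕ) : Prop :=
  IsGood (-((t : ℤ) + 1)) (w t) F (track I F w t) v

variable {I F : Set V} {w : ℕ → V → V → Prop}

theorem prefixClosed_track (t : ℕ) : PrefixClosed (track I F w t) := by
  cases t with
  | succ t => exact prefixClosed_trunc _
  | zero =>
    intro q v hv h
    refine ⟨q, ?_⟩
    simp only [track] at h ⊢
    split at h
    · next hq =>
      rw [if_pos hq]
      exact (h.eq_of_length_le (List.length_pos_iff.2 hv)).symm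
    · exact absurd (List.prefix_nil.1 h) hv

theorem mem_track {t : ℕ} {q : V} {s : ℤ} (h : s ∈ track I F w t q) : -(t : ℤ) ≤ s ∧ s ≤ 0 := by
  induction t generalizing q with
  | zero =>
    simp only [track] at h
    split at h <;> simp_all
  | succ t ih =>
    rcases mem_of_mem_step h with h | ⟨p, hp⟩
    · subst h; push_cast; omega
    · have := ih hp; push_cast; omega

theorem not_mem_track {t t' : ℕ} (ht : t ≤ t') (q : V) : -((t' : ℤ) + 1) ∉ track I F w t q := by
  intro h
  have := mem_track h
  omega

/-- A node that is good at infinitely many steps is alive from some time on. -/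
theorem exists_alive_of_good {v : List ℤ} (hv : ∃ᶠ t in atTop, GoodAt I F w v t) :
    v ≠ [] ∧ ∃ t₀, ∀ t, t₀ ≤ t → v ∈ Set.range (track I F w t) ∧ -((t : ℤ) + 1) ∉ v := by
  obtain ⟨t₀, hgood₀⟩ := hv.exists
  have hv0 : v ≠ [] := hgood₀.1
  rw [frequently_atTop] at hv
  have hfresh : ∀ t, t₀ + 1 ≤ t → -((t : ℤ) + 1) ∉ v := fun t ht => by
    obtain ⟨q, hq⟩ := hgood₀.2.1
    rw [← hq]
    exact not_mem_track (t := t₀ + 1) ht q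
  refine ⟨hv0, t₀ + 1, fun t ht => ⟨?_, hfresh t ht⟩⟩
  obtain ⟨t', ht', hg⟩ := hv t
  -- The node exists just after some later good step; since its last stamp is not fresh in between,
  -- it was inherited all the way from `t`.
  exact Nat.decreasingInduction' (P := fun t => v ∈ Set.range (track I F w t))
    (fun k _ hk h => mem_range_of_mem_range_step (prefixClosed_track k) hv0
      (fun h => hfresh k (ht.trans hk) (List.mem_of_getLast? h)) h) (Nat.le_succ_of_le ht') hg.2.1

/-- A node that is good at infinitely many steps yields an accepting run. -/
theorem exists_run_of_good {v : List ℤ} (hv : ∃ᶠ t in atTop, GoodAt I F w v t) :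
    ∃ ρ : ℕ → V, ρ 0 ∈ I ∧ (∀ t, w t (ρ t) (ρ (t + 1))) ∧ ∃ᶠ t in atTop, ρ t ∈ F := by
  obtain ⟨hv0, t₀, h₀⟩ := exists_alive_of_good hv
  have halive : ∀ t, t₀ ≤ t → v ∈ Set.range (track I F w t) := fun t ht => (h₀ t ht).1
  have hlast : ∀ t, t₀ ≤ t → v.getLast? ≠ some (-((t : ℤ) + 1)) := fun t ht h =>
    (h₀ t ht).2 (List.mem_of_getLast? h)
  rw [frequently_atTop] at hv
  have hpr : ∀ (t : ℕ) q, ∃ p, raw (-((t : ℤ) + 1)) (w t) F (track I F w t) q ≠ [] →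
      w t p q ∧ track I F w t p ≠ [] ∧ track I F w t p = bestPred (w t) (track I F w t) q := by
    intro t q
    by_cases h : raw (-((t : ℤ) + 1)) (w t) F (track I F w t) q ≠ []
    · obtain ⟨p, hp⟩ := exists_pred h
      exact ⟨p, fun _ => hp⟩
    · exact ⟨q, fun h' => absurd h' h⟩
  choose pr hpr using hpr
  -- States that can be reached and, from `t₀` on, sit at or below `v`. Predecessors realizing the
  -- inherited path stay in these sets.
  let T : ℕ → Set V := fun t => {q | track I F w t q ≠ [] ∧ (t₀ ≤ t → v <+: track I F w t q)}
  have hstep : ∀ t q, q ∈ T (t + 1) → pr t q ∈ T t := by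
    intro t q hq
    have hraw : raw (-((t : ℤ) + 1)) (w t) F (track I F w t) q ≠ [] := fun h =>
      hq.1 (trunc_eq_nil_iff.2 h)
    obtain ⟨-, h2, h3⟩ := hpr t q hraw
    refine ⟨h2, fun ht => ?_⟩
    rw [h3]
    exact prefix_bestPred (hlast t ht) ((hq.2 (by omega)).trans (trunc_prefix _ _))
  have hne : ∀ t, (T t).Nonempty := by
    intro t
    by_cases ht : t₀ ≤ t
    · obtain ⟨q, hq⟩ := halive t ht
      exact ⟨q, by rw [hq]; exact hv0, fun _ => by rw [hq]⟩
    · refine Nat.decreasingInduction' (P := fun t => (T t).Nonempty)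
        (fun k _ _ h => h.elim fun q hq => ⟨_, hstep k q hq⟩) (le_of_not_ge ht) ?_
      obtain ⟨q, hq⟩ := halive (t₀) le_rfl
      exact ⟨q, by rw [hq]; exact hv0, fun _ => by rw [hq]⟩
  obtain ⟨ρ, hρ⟩ := exists_backward_path T hne pr hstep
  have hrawρ : ∀ t : ℕ, raw (-((t : ℤ) + 1)) (w t) F (track I F w t) (ρ (t + 1)) ≠ [] := fun t h =>
    (hρ (t + 1)).1.1 (trunc_eq_nil_iff.2 h)
  refine ⟨ρ, ?_, fun t => ?_, ?_⟩
  · have := (hρ 0).1.1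
    simp only [track] at this
    by_contra h
    simp [h] at this
  · have := (hpr t _ (hrawρ t)).1
    rwa [← (hρ t).2] at this
  · by_contra hF
    rw [not_frequently, eventually_atTop] at hF
    obtain ⟨N, hN⟩ := hF
    -- Suppose `ρ` avoids `F` from `N` on. A good step collapses its path to exactly `v`, after
    -- which no child is opened and the path remains `v`. Then `v` is a raw path at the next good
    -- step, a contradiction.
    obtain ⟨t₁, ht₁, hg₁⟩ := hv (max N (t₀))
    have hraw : ∀ t, t₁ ≤ t → raw (-((t : ℤ) + 1)) (w t) F (track I F w t) (ρ (t + 1)) =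
        track I F w t (ρ t) := fun t ht => by
      rw [raw_of_not_mem (hN (t + 1) (by omega)), ← (hpr t _ (hrawρ t)).2.2, ← (hρ t).2]
    have hconst : ∀ t, t₁ + 1 ≤ t → track I F w t (ρ t) = v := by
      intro t ht
      induction t, ht using Nat.le_induction with
      | base =>
        exact trunc_eq_of_not_mem hv0 ((hρ (t₁ + 1)).1.2 (by omega)) hg₁.2.2
      | succ t ht ih =>
        have h1 : v <+: track I F w (t + 1) (ρ (t + 1)) := (hρ (t + 1)).1.2 (by omega)
        have h2 := trunc_prefix (raw (-((t : ℤ) + 1)) (w t) F (track I F w t)) (ρ (t + 1))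
        rw [hraw t (by omega), ih] at h2
        exact h2.eq_of_length_le h1.length_le
    obtain ⟨t₂, ht₂, hg₂⟩ := hv (t₁ + 1)
    exact hg₂.2.2 ⟨ρ (t₂ + 1), by rw [hraw t₂ (by omega), hconst t₂ ht₂]⟩

/-- An accepting run yields a node that is good at infinitely many steps. -/
theorem exists_good_of_run {ρ : ℕ → V} (h0 : ρ 0 ∈ I) (hρ : ∀ t, w t (ρ t) (ρ (t + 1)))
    (hF : ∃ᶠ t in atTop, ρ t ∈ F) : ∃ v, ∃ᶠ t in atTop, GoodAt I F w v t := by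
  set p : ℕ → List ℤ := fun t => track I F w t (ρ t) with hp
  set r : ℕ → List ℤ := fun t => raw (-((t : ℤ) + 1)) (w t) F (track I F w t) (ρ (t + 1)) with hr
  have hbest : ∀ t, p t ≤ bestPred (w t) (track I F w t) (ρ (t + 1)) := fun t =>
    le_bestPred (hρ t)
  have hpr : ∀ t, p t ≤ r t := fun t => (hbest t).trans (prefix_le (bestPred_prefix_raw _ _ _ _ _))
  have hrp : ∀ t, p (t + 1) <+: r t := fun t => trunc_prefix _ _
  have hnil : ∀ l : List ℤ, l ≤ [] → l = [] := fun l h => h.antisymm (prefix_le List.nil_prefix)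
  have hne : ∀ t, p t ≠ [] := by
    intro t
    induction t with
    | zero => simp [hp, track, h0]
    | succ t ih =>
      intro h
      have h1 : r t = [] :=
        (trunc_eq_nil_iff (R := raw (-((t : ℤ) + 1)) (w t) F (track I F w t)) (q := ρ (t + 1))).1 h
      exact ih (hnil _ (h1 ▸ hpr t))
  -- `k` is the limit inferior of the path lengths along the run.
  obtain ⟨k, hk, hk'⟩ : ∃ k, (∀ᶠ t in atTop, k ≤ (p t).length) ∧
      ∃ᶠ t in atTop, (p t).length ≤ k := by
    classical
    have hex : ∃ k, ∃ᶠ t in atTop, (p t).length ≤ k := ⟨Fintype.card V,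
      Frequently.of_forall fun t => length_le_card (prefixClosed_track t) _⟩
    refine ⟨Nat.find hex, ?_, Nat.find_spec hex⟩
    rcases Nat.eq_zero_or_pos (Nat.find hex) with h | h
    · rw [h]; exact Eventually.of_forall fun _ => Nat.zero_le _
    · have := Nat.find_min hex (Nat.sub_lt h one_pos)
      rw [not_frequently] at this
      filter_upwards [this] with t ht
      omega
  obtain ⟨N, hN⟩ := eventually_atTop.1 hk
  -- Inheritance never decreases the path, and truncation leaves its first `k` entries untouched.
  obtain ⟨v, hv⟩ : ∃ v, ∀ᶠ t in atTop, (p (t + N)).take k = v := by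
    refine eventually_const_of_monotone k _ (fun t => ?_) (fun t => ?_) (fun t s hs => ?_)
    · rw [List.length_take]; exact min_eq_left (hN _ (by omega))
    · rw [show t + 1 + N = t + N + 1 by omega]
      obtain ⟨u, hu⟩ := hrp (t + N)
      have h1 := take_le_take (hpr (t + N)) k
      rwa [← hu, List.take_append_of_le_length (hN _ (by omega))] at h1
    · exact (mem_track (List.mem_of_mem_take hs)).2
  obtain ⟨M₀, hM₀⟩ := eventually_atTop.1 hv
  obtain ⟨M, hMN, hM⟩ : ∃ M, N ≤ M ∧ ∀ t, M ≤ t → (p t).take k = v := by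
    refine ⟨M₀ + N, by omega, fun t ht => ?_⟩
    have := hM₀ (t - N) (by omega)
    rwa [show t - N + N = t by omega] at this
  have hpre : ∀ t, M ≤ t → v <+: p t := fun t ht => hM t ht ▸ List.take_prefix _ _
  have hvk : v.length = k := by
    rw [← hM M le_rfl, List.length_take]
    exact min_eq_left (hN _ hMN)
  have hkpos : k ≠ 0 := by
    rintro rfl
    obtain ⟨t, ht⟩ := hk'.exists
    exact hne t (List.length_eq_zero_iff.1 (by omega))
  have hv0 : v ≠ [] := fun h => hkpos (by simpa [h] using hvk.symm)
  have heq : ∃ᶠ t in atTop, p t = v := by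
    refine (hk'.and_eventually (eventually_ge_atTop M)).mono fun t ht => ?_
    exact ((hpre t ht.2).eq_of_length_le (by omega)).symm
  refine ⟨v, ?_⟩
  by_contra hg
  rw [not_frequently, eventually_atTop] at hg
  obtain ⟨G, hG⟩ := hg
  -- Without goodness, truncation cannot shorten a path to `v`: if `v` is a raw path, the cut does
  -- not stop there.
  have hstay : ∀ t, M ≤ t → G ≤ t → r t ≠ v → p (t + 1) ≠ v := by
    intro t hMt hGt hrt h
    refine hG t hGt ⟨hv0, ⟨_, h⟩, ?_⟩
    rintro ⟨q, hq⟩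
    have h2 : (r t).take (cut (raw (-((t : ℤ) + 1)) (w t) F (track I F w t)) (r t)) = v := h
    rcases (cut_mem (raw (-((t : ℤ) + 1)) (w t) F (track I F w t)) (r t)).2 with h3 | h3
    · rw [List.take_of_length_le h3] at h2
      exact hrt h2
    · exact h3 ⟨q, hq.trans h2.symm⟩
  -- On arrival in `F` the raw path contains the fresh stamp, so it differs from `v`. From then on
  -- the path stays strictly below `v`, against `heq`.
  obtain ⟨t₁, ht₁, hFt⟩ := frequently_atTop.1 hF (max M G + 1)
  have hbase : p t₁ ≠ v := by
    obtain ⟨t, rfl⟩ : ∃ t, t₁ = t + 1 := ⟨t₁ - 1, by omega⟩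
    refine hstay t (by omega) (by omega) fun h => ?_
    have hb : bestPred (w t) (track I F w t) (ρ (t + 1)) ≠ [] := fun h' =>
      hne t (hnil _ (h' ▸ hbest t))
    have h1 : r t = _ ++ [_] := raw_of_mem hFt hb
    have h2 : -((t : ℤ) + 1) ∈ v := by rw [← h, h1]; simp
    exact not_mem_track le_rfl _ ((hpre t (by omega)).subset h2)
  obtain ⟨t₂, ht₂, h₂⟩ := frequently_atTop.1 heq t₁
  refine absurd h₂ ?_
  clear h₂
  induction t₂, ht₂ using Nat.le_induction with
  | base => exact hbase
  | succ t ht ih =>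
    refine hstay t (by omega) (by omega) fun h => ih ?_
    exact (h ▸ hpr t).antisymm (prefix_le (hpre t (by omega)))

/-! ### Relabelling of stamps -/

variable {V : Type*} [Fintype V]

theorem map_le_map {g : ℤ → ℤ} {U : Set ℤ} (hg : StrictMonoOn g U) {l m : List ℤ}
    (hl : ∀ s ∈ l, s ∈ U) (hm : ∀ s ∈ m, s ∈ U) (h : l ≤ m) : l.map g ≤ m.map g := by
  induction l generalizing m with
  | nil => exact prefix_le List.nil_prefix
  | cons a l ih =>
    cases m with
    | nil => exact absurd (h.antisymm (prefix_le List.nil_prefix)) (by simp)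
    | cons b m =>
      simp only [List.forall_mem_cons] at hl hm
      rw [cons_le_cons_iff] at h
      rw [List.map_cons, List.map_cons, cons_le_cons_iff]
      exact h.imp (fun h => hg hl.1 hm.1 h) fun h => ⟨congrArg g h.1, ih hl.2 hm.2 h.2⟩

theorem map_injOn {g : ℤ → ℤ} {U : Set ℤ} (hg : Set.InjOn g U) {l m : List ℤ}
    (hl : ∀ s ∈ l, s ∈ U) (hm : ∀ s ∈ m, s ∈ U) (h : l.map g = m.map g) : l = m := by
  induction l generalizing m with
  | nil => simpa [eq_comm] using h
  | cons a l ih =>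
    cases m with
    | nil => simp at h
    | cons b m =>
      simp only [List.forall_mem_cons] at hl hm
      simp only [List.map_cons, List.cons.injEq] at h
      rw [hg hl.1 hm.1 h.1, ih hl.2 hm.2 h.2]

open Classical in
theorem best_image {g : ℤ → ℤ} {U : Set ℤ} (hg : StrictMonoOn g U) {S : Finset (List ℤ)}
    (hS : ∀ l ∈ S, ∀ s ∈ l, s ∈ U) : best (S.image (List.map g)) = (best S).map g := by
  rcases S.eq_empty_or_nonempty with rfl | hne
  · simp [best_empty]
  · refine le_antisymm ?_ (le_best (Finset.mem_image_of_mem _ (best_mem hne)))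
    obtain ⟨l, hl, h⟩ := Finset.mem_image.1 (best_mem (hne.image (List.map g)))
    rw [← h]
    exact map_le_map hg (hS l hl) (hS _ (best_mem hne)) (le_best hl)

/-- The stamps that occur on the paths. -/
noncomputable def stamps (P : V → List ℤ) : Finset ℤ :=
  Finset.univ.biUnion fun q => (P q).toFinset

def relabel (g : ℤ → ℤ) (P : V → List ℤ) (q : V) : List ℤ := (P q).map g

theorem mem_stamps {P : V → List ℤ} {s : ℤ} : s ∈ stamps P ↔ ∃ q, s ∈ P q := by
  simp [stamps]

theorem stamps_relabel (g : ℤ → ℤ) (P : V → List ℤ) :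
    stamps (relabel g P) = (stamps P).image g := by
  ext s
  simp only [mem_stamps, relabel, List.mem_map, Finset.mem_image]
  constructor
  · rintro ⟨q, u, hu, rfl⟩; exact ⟨u, ⟨q, hu⟩, rfl⟩
  · rintro ⟨u, ⟨q, hu⟩, rfl⟩; exact ⟨q, u, hu, rfl⟩

omit [Fintype V] in
theorem relabel_congr {g g' : ℤ → ℤ} {P : V → List ℤ} (h : ∀ q, ∀ s ∈ P q, g s = g' s) :
    relabel g P = relabel g' P :=
  funext fun q => List.map_congr_left (h q)

omit [Fintype V] in
theorem prefixClosed_relabel {P : V → List ℤ} (hP : PrefixClosed P) (g : ℤ → ℤ) :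
    PrefixClosed (relabel g P) := by
  intro q v hv h
  have h1 : v = ((P q).take v.length).map g := by
    rw [List.map_take]; exact List.prefix_iff_eq_take.1 h
  obtain ⟨p, hp⟩ := hP q ((P q).take v.length)
    (fun h' => hv (by rw [h1, h', List.map_nil])) (List.take_prefix _ _)
  exact ⟨p, by rw [h1, ← hp, relabel]⟩

theorem bestPred_relabel {g : ℤ → ℤ} {P : V → List ℤ} (hg : StrictMonoOn g (stamps P))
    (L : V → V → Prop) (q : V) : bestPred L (relabel g P) q = (bestPred L P q).map g := by
  classical
  unfold bestPred
  rw [← best_image hg, Finset.image_image]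
  · congr!
  · intro l hl s hs
    obtain ⟨p, -, rfl⟩ := Finset.mem_image.1 hl
    exact mem_stamps.2 ⟨p, hs⟩

theorem raw_relabel {g : ℤ → ℤ} {P : V → List ℤ} (hg : StrictMonoOn g (stamps P)) (f : ℤ)
    (L : V → V → Prop) (F : Set V) :
    raw (g f) L F (relabel g P) = relabel g (raw f L F P) := by
  funext q
  by_cases h : q ∈ F ∧ bestPred L P q ≠ [] <;> simp [raw, relabel, bestPred_relabel hg, h]

omit [Fintype V] in
theorem map_mem_range_relabel {g : ℤ → ℤ} {U : Set ℤ} (hg : Set.InjOn g U) {R : V → List ℤ}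
    (hR : ∀ q, ∀ s ∈ R q, s ∈ U) {l : List ℤ} (hl : ∀ s ∈ l, s ∈ U) :
    l.map g ∈ Set.range (relabel g R) ↔ l ∈ Set.range R := by
  constructor
  · rintro ⟨q, hq⟩
    exact ⟨q, map_injOn hg (hR q) hl hq⟩
  · rintro ⟨q, rfl⟩
    exact ⟨q, rfl⟩

omit [Fintype V] in
-- Truncation only tests paths for equality, so injectivity on the stamps suffices.
theorem trunc_relabel {g : ℤ → ℤ} {U : Set ℤ} (hg : Set.InjOn g U) {R : V → List ℤ}
    (hR : ∀ q, ∀ s ∈ R q, s ∈ U) : trunc (relabel g R) = relabel g (trunc R) := by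
  funext q
  have : cut (relabel g R) ((R q).map g) = cut R (R q) := by
    unfold cut
    congr 1
    ext k
    simp only [Set.mem_ofPred_eq, List.length_map, ← List.map_take]
    rw [map_mem_range_relabel hg hR fun s hs => hR q s (List.mem_of_mem_take hs)]
  rw [trunc, relabel, relabel, trunc, List.map_take, this]

theorem mem_raw {f : ℤ} {L : V → V → Prop} {F : Set V} {P : V → List ℤ} {q : V} {s : ℤ}
    (h : s ∈ raw f L F P q) : s ∈ insert f (stamps P) := by
  obtain ⟨p, -, -, hp⟩ := exists_pred (List.ne_nil_of_mem h)
  have h2 := (raw_prefix f L F P q).subset h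
  rw [← hp, List.mem_append, List.mem_singleton] at h2
  rw [Finset.mem_insert, mem_stamps]
  exact h2.symm.imp id fun h => ⟨p, h⟩

theorem mem_step {f : ℤ} {L : V → V → Prop} {F : Set V} {P : V → List ℤ} {q : V} {s : ℤ}
    (h : s ∈ step f L F P q) : s ∈ insert f (stamps P) :=
  mem_raw ((trunc_prefix _ _).subset h)

theorem stamps_step_subset (f : ℤ) (L : V → V → Prop) (F : Set V) (P : V → List ℤ) :
    stamps (step f L F P) ⊆ insert f (stamps P) := fun _ hs =>
  (mem_stamps.1 hs).elim fun _ h => mem_step h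

/-- Maxima need only the order of the stamps and truncation only their identity. The relabelling
must also be increasing at the fresh stamp. -/
theorem step_relabel {f : ℤ} {g : ℤ → ℤ} {P : V → List ℤ}
    (hg : StrictMonoOn g (insert f (stamps P) : Finset ℤ)) (L : V → V → Prop) (F : Set V) :
    step (g f) L F (relabel g P) = relabel g (step f L F P) := by
  rw [step, raw_relabel (hg.mono (by simp)), trunc_relabel hg.injOn fun q s hs => mem_raw hs]
  rfl

theorem isGood_relabel {f : ℤ} {g : ℤ → ℤ} {P : V → List ℤ}
    (hg : StrictMonoOn g (insert f (stamps P) : Finset ℤ)) (L : V → V → Prop) (F : Set V) {v : List ℤ}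
    (hv : ∀ s ∈ v, s ∈ insert f (stamps P)) :
    IsGood (g f) L F (relabel g P) (v.map g) ↔ IsGood f L F P v := by
  rw [IsGood, step_relabel hg, raw_relabel (hg.mono (by simp)),
    map_mem_range_relabel hg.injOn (fun q s hs => mem_raw hs) hv,
    map_mem_range_relabel hg.injOn (fun q s hs => mem_step hs) hv, IsGood]
  simp

/-! ### Ranks of stamps -/

/-- The number of stamps of `U` that are older than `s`. -/
def idx (U : Finset ℤ) (s : ℤ) : ℕ := (U.filter (s < ·)).card

theorem idx_lt {U : Finset ℤ} {s t : ℤ} (ht : t ∈ U) (h : s < t) : idx U t < idx U s :=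
  Finset.card_lt_card ((Finset.ssubset_iff_of_subset fun u hu => by
    simp only [Finset.mem_filter] at hu ⊢
    exact ⟨hu.1, h.trans hu.2⟩).2 ⟨t, by simp [ht, h], by simp⟩)

theorem idx_le {U : Finset ℤ} {s t : ℤ} (h : s ≤ t) : idx U t ≤ idx U s :=
  Finset.card_le_card fun u hu => by
    simp only [Finset.mem_filter] at hu ⊢
    exact ⟨hu.1, h.trans_lt hu.2⟩

theorem idx_lt_card {U : Finset ℤ} {s : ℤ} (h : s ∈ U) : idx U s < U.card :=
  Finset.card_lt_card ((Finset.ssubset_iff_of_subset (Finset.filter_subset _ _)).2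
    ⟨s, h, by simp⟩)

theorem idx_image {U : Finset ℤ} {g : ℤ → ℤ} (hg : StrictMonoOn g U) {s : ℤ} (hs : s ∈ U) :
    idx (U.image g) (g s) = idx U s := by
  have : (U.image g).filter (g s < ·) = (U.filter (s < ·)).image g := by
    ext u
    simp only [Finset.mem_filter, Finset.mem_image]
    constructor
    · rintro ⟨⟨a, ha, rfl⟩, h⟩
      exact ⟨a, ⟨ha, (hg.lt_iff_lt hs ha).1 h⟩, rfl⟩
    · rintro ⟨a, ⟨ha, h⟩, rfl⟩
      exact ⟨⟨a, ha, rfl⟩, hg hs ha h⟩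
  rw [idx, this, Finset.card_image_of_injOn]
  · rfl
  · exact hg.injOn.mono fun u hu => (Finset.mem_filter.1 hu).1

/-- By prefix closure, the path up to an occurrence of a stamp belongs to some state, so each stamp
is the last stamp of some state's path. -/
theorem card_stamps_le {P : V → List ℤ} (hP : PrefixClosed P) :
    (stamps P).card ≤ Fintype.card V := by
  classical
  refine (Finset.card_le_card (t := Finset.univ.image fun q => (P q).getLastD 0) ?_).trans
    Finset.card_image_le
  intro s hs
  obtain ⟨q, hq⟩ := mem_stamps.1 hs
  obtain ⟨a, b, hab⟩ := List.append_of_mem hq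
  obtain ⟨p, hp⟩ := hP q (a ++ [s]) (by simp) ⟨b, by rw [hab]; simp⟩
  exact Finset.mem_image.2 ⟨p, Finset.mem_univ _, by simp [hp]⟩

/-- Every stamp is replaced by minus its rank. -/
noncomputable def compress (P : V → List ℤ) : V → List ℤ :=
  relabel (fun s => -(idx (stamps P) s : ℤ)) P

theorem compress_relabel {g : ℤ → ℤ} {P : V → List ℤ} (hg : StrictMonoOn g (stamps P)) :
    compress (relabel g P) = compress P := by
  rw [compress, stamps_relabel]
  funext q
  simp only [relabel, compress, List.map_map]
  refine List.map_congr_left fun s hs => ?_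
  simp only [Function.comp]
  rw [idx_image hg (mem_stamps.2 ⟨q, hs⟩)]

/-- Some stamp of rank at most `i` disappears. -/
def Bad (f : ℤ) (L : V → V → Prop) (F : Set V) (P : V → List ℤ) (i : ℕ) : Prop :=
  ∃ s ∈ stamps P, idx (stamps P) s ≤ i ∧ s ∉ stamps (step f L F P)

/-- Some node whose stamp has rank `i` is good. -/
def Good (f : ℤ) (L : V → V → Prop) (F : Set V) (P : V → List ℤ) (i : ℕ) : Prop :=
  ∃ s ∈ stamps P, idx (stamps P) s = i ∧ ∃ v, v.getLast? = some s ∧ IsGood f L F P v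

/-! ### Invariance of bad and good ranks under relabelling -/

section

variable {f : ℤ} {g : ℤ → ℤ} {P : V → List ℤ}

theorem bad_relabel (hg : StrictMonoOn g (insert f (stamps P) : Finset ℤ)) (L : V → V → Prop)
    (F : Set V) (i : ℕ) : Bad (g f) L F (relabel g P) i ↔ Bad f L F P i := by
  have hg' : StrictMonoOn g (stamps P) := hg.mono (by simp)
  simp only [Bad, step_relabel hg, stamps_relabel, Finset.exists_mem_image]
  refine exists_congr fun s => and_congr_right fun hs => ?_
  rw [idx_image hg' hs]
  refine and_congr_right fun _ => not_congr ?_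
  constructor
  · intro h
    obtain ⟨u, hu, hus⟩ := Finset.mem_image.1 h
    rwa [← hg.injOn (stamps_step_subset _ _ _ _ hu) (Finset.mem_insert_of_mem hs) hus]
  · exact Finset.mem_image_of_mem _

theorem good_relabel (hg : StrictMonoOn g (insert f (stamps P) : Finset ℤ)) (L : V → V → Prop)
    (F : Set V) (i : ℕ) : Good (g f) L F (relabel g P) i ↔ Good f L F P i := by
  have hg' : StrictMonoOn g (stamps P) := hg.mono (by simp)
  simp only [Good, stamps_relabel, Finset.exists_mem_image]
  refine exists_congr fun s => and_congr_right fun hs => ?_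
  rw [idx_image hg' hs]
  refine and_congr_right fun _ => ?_
  constructor
  · rintro ⟨v, hv, hgood⟩
    obtain ⟨q, hq⟩ := hgood.2.1
    rw [step_relabel hg] at hq
    subst hq
    have hmem : ∀ s ∈ step f L F P q, s ∈ insert f (stamps P) := fun s hs => mem_step hs
    rw [relabel, isGood_relabel hg L F hmem] at hgood
    refine ⟨_, ?_, hgood⟩
    rw [relabel, List.getLast?_map, Option.map_eq_some_iff] at hv
    obtain ⟨u, hu, hus⟩ := hv
    rw [hu, hg.injOn (hmem u (List.mem_of_getLast? hu)) (Finset.mem_insert_of_mem hs) hus]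
  · rintro ⟨v, hv, hgood⟩
    refine ⟨v.map g, by rw [List.getLast?_map, hv]; rfl, (isGood_relabel hg L F ?_).2 hgood⟩
    obtain ⟨q, hq⟩ := hgood.2.1
    rw [← hq]
    exact fun s hs => mem_step hs

end

/-- Compression does not change the behaviour under one step. -/
theorem exists_relabel_eq_compress {P : V → List ℤ} (hP : PrefixClosed P) {f : ℤ}
    (hf : ∀ s ∈ stamps P, f < s) :
    ∃ g : ℤ → ℤ, StrictMonoOn g (insert f (stamps P) : Finset ℤ) ∧ relabel g P = compress P ∧
      g f = -(Fintype.card V : ℤ) := by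
  have hf' : f ∉ stamps P := fun h => lt_irrefl _ (hf f h)
  have hlt : ∀ s ∈ stamps P, -(Fintype.card V : ℤ) < -(idx (stamps P) s : ℤ) := fun s hs => by
    have := (idx_lt_card hs).trans_le (card_stamps_le hP)
    omega
  -- Ranks are less than the number of states, so minus that number is below every compressed stamp
  -- and can act as the fresh one.
  refine ⟨fun s => if s = f then -(Fintype.card V : ℤ) else -(idx (stamps P) s : ℤ), ?_, ?_,
    if_pos rfl⟩
  · intro a ha b hb hab
    rw [Finset.mem_coe, Finset.mem_insert] at ha hb
    have hbf : b ≠ f := by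
      rintro rfl
      rcases ha with ha | ha
      · omega
      · exact absurd (hf a ha) hab.not_gt
    have hb' := hb.resolve_left hbf
    simp only [if_neg hbf]
    split
    · exact hlt b hb'
    · have := idx_lt hb' hab
      omega
  · refine relabel_congr fun q s hs => if_neg ?_
    rintro rfl
    exact hf' (mem_stamps.2 ⟨q, hs⟩)

/-! ### Acceptance in terms of ranks -/

section

variable {V : Type*} [Fintype V] {I F : Set V} {w : ℕ → V → V → Prop}

def BadAt (I F : Set V) (w : ℕ → V → V → Prop) (i t : ℕ) : Prop :=
  Bad (-((t : ℤ) + 1)) (w t) F (track I F w t) i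

def GoodRankAt (I F : Set V) (w : ℕ → V → V → Prop) (i t : ℕ) : Prop :=
  Good (-((t : ℤ) + 1)) (w t) F (track I F w t) i

theorem fresh_lt {t : ℕ} {s : ℤ} (h : s ∈ stamps (track I F w t)) : -((t : ℤ) + 1) < s := by
  obtain ⟨q, hq⟩ := mem_stamps.1 h
  have := mem_track hq
  omega

/-- The only stamp that can appear is the fresh one, which is the youngest. Hence the rank of a
surviving stamp never increases. -/
theorem filter_stamps_succ_subset {t : ℕ} {s : ℤ} (h : s ∈ stamps (track I F w t)) :
    (stamps (track I F w (t + 1))).filter (s < ·) ⊆ (stamps (track I F w t)).filter (s < ·) := by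
  intro u hu
  rw [Finset.mem_filter] at hu ⊢
  refine ⟨(Finset.mem_insert.1 (stamps_step_subset _ _ _ _ hu.1)).resolve_left ?_, hu.2⟩
  rintro rfl
  exact absurd (fresh_lt h) hu.2.not_gt

/-- Once no stamp of rank at most `i` is lost, one fixed stamp holds rank `i` forever. Several nodes
may end in it, but all of them already exist at `t₀`, so by pigeonhole one of them is good
infinitely often. -/
theorem exists_good_of_rank {i : ℕ} (hgood : ∃ᶠ t in atTop, GoodRankAt I F w i t)
    (hbad : ∀ᶠ t in atTop, ¬ BadAt I F w i t) : ∃ v, ∃ᶠ t in atTop, GoodAt I F w v t := by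
  obtain ⟨N, hN⟩ := eventually_atTop.1 hbad
  obtain ⟨t₀, ht₀, s, hs, hsi, -⟩ := frequently_atTop.1 hgood N
  have hstable : ∀ t, t₀ ≤ t →
      s ∈ stamps (track I F w t) ∧ idx (stamps (track I F w t)) s = i := by
    intro t ht
    induction t, ht using Nat.le_induction with
    | base => exact ⟨hs, hsi⟩
    | succ t ht ih =>
      have hkeep : ∀ u ∈ stamps (track I F w t), idx (stamps (track I F w t)) u ≤ i →
          u ∈ stamps (track I F w (t + 1)) := fun u hu hui => by
        by_contra h
        exact hN t (by omega) ⟨u, hu, hui, h⟩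
      refine ⟨hkeep s ih.1 ih.2.le, ?_⟩
      have : (stamps (track I F w (t + 1))).filter (s < ·) =
          (stamps (track I F w t)).filter (s < ·) := by
        refine (filter_stamps_succ_subset ih.1).antisymm fun u hu => ?_
        rw [Finset.mem_filter] at hu ⊢
        exact ⟨hkeep u hu.1 ((idx_le hu.2.le).trans ih.2.le), hu.2⟩
      rw [← ih.2, idx, this, idx]
  have hnode : ∀ t, t₀ ≤ t → GoodRankAt I F w i t →
      ∃ q, GoodAt I F w (track I F w t₀ q) t := by
    rintro t ht ⟨s', hs', hsi', v, hv, hgv⟩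
    obtain rfl : s' = s := by
      have h := hstable t ht
      rcases lt_trichotomy s' s with h' | h' | h'
      · have := idx_lt h.1 h'; omega
      · exact h'
      · have := idx_lt hs' h'; omega
    have : v ∈ Set.range (track I F w t₀) := by
      refine Nat.decreasingInduction' (P := fun t => v ∈ Set.range (track I F w t))
        (fun k _ hk h => mem_range_of_mem_range_step (prefixClosed_track k) hgv.1 ?_ h)
        (Nat.le_succ_of_le ht) hgv.2.1
      rw [hv]
      intro h
      have := fresh_lt (hstable k hk).1
      rw [Option.some.injEq] at h
      omega
    obtain ⟨q, hq⟩ := this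
    exact ⟨q, hq ▸ hgv⟩
  by_contra hno
  push Not at hno
  have : ∀ᶠ t in atTop, ∀ q, ¬ GoodAt I F w (track I F w t₀ q) t :=
    eventually_all.2 fun q => hno _
  obtain ⟨t, h1, h2, h3⟩ :=
    (hgood.and_eventually (this.and (eventually_ge_atTop t₀))).exists
  obtain ⟨q, hq⟩ := hnode t h3 h1
  exact h2 q hq

/-- The rank of the last stamp of `v` is nonincreasing, so it stabilizes. Losing an older stamp
later would lower it again, and the stamp itself survives with `v`. -/
theorem exists_rank_of_good {v : List ℤ} (hv : ∃ᶠ t in atTop, GoodAt I F w v t) :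
    ∃ i < Fintype.card V, (∃ᶠ t in atTop, GoodRankAt I F w i t) ∧
      ∀ᶠ t in atTop, ¬ BadAt I F w i t := by
  obtain ⟨hv0, t₀, h₀⟩ := exists_alive_of_good hv
  obtain ⟨s, hs⟩ : ∃ s, v.getLast? = some s := ⟨_, List.getLast?_eq_some_getLast hv0⟩
  have hmem : ∀ t, t₀ ≤ t → s ∈ stamps (track I F w t) := fun t ht => by
    obtain ⟨q, hq⟩ := (h₀ t ht).1
    exact mem_stamps.2 ⟨q, hq ▸ List.mem_of_getLast? hs⟩
  obtain ⟨N, hN⟩ := WellFoundedGT.monotone_chain_condition (α := ℕᵒᵈ)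
    ⟨fun t => OrderDual.toDual (idx (stamps (track I F w (t + t₀))) s),
      monotone_nat_of_le_succ fun t => by
        rw [OrderDual.toDual_le_toDual, show t + 1 + t₀ = t + t₀ + 1 by omega]
        exact Finset.card_le_card (filter_stamps_succ_subset (hmem _ (by omega)))⟩
  set i := idx (stamps (track I F w (N + t₀))) s with hi
  have hconst : ∀ t, N + t₀ ≤ t → idx (stamps (track I F w t)) s = i := fun t ht => by
    have : i = idx (stamps (track I F w (t - t₀ + t₀))) s :=
      OrderDual.toDual.injective (hN (t - t₀) (by omega))
    rw [this, Nat.sub_add_cancel (by omega)]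
  refine ⟨i, (idx_lt_card (hmem _ (by omega))).trans_le (card_stamps_le (prefixClosed_track _)),
    ?_, ?_⟩
  · refine (hv.and_eventually (eventually_ge_atTop (N + t₀))).mono ?_
    rintro t ⟨hg, ht⟩
    exact ⟨s, hmem t (by omega), hconst t ht, v, hs, hg⟩
  · refine eventually_atTop.2 ⟨N + t₀, ?_⟩
    rintro t ht ⟨u, hu, hui, hu'⟩
    have hus : s ≤ u := by
      by_contra h
      have := idx_lt (hmem t (by omega)) (not_le.1 h)
      have := hconst t ht
      omega
    rcases hus.eq_or_lt with rfl | hus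
    · exact hu' (hmem (t + 1) (by omega))
    · have := Finset.eq_of_subset_of_card_le (filter_stamps_succ_subset (hmem t (by omega)))
        ((hconst t ht).trans (hconst (t + 1) (by omega)).symm).le
      have h2 : u ∈ (stamps (track I F w t)).filter (s < ·) := Finset.mem_filter.2 ⟨hu, hus⟩
      rw [← this] at h2
      exact hu' (Finset.mem_filter.1 h2).1

end

/-! ### The finite automaton -/

variable {V : Type} [Fintype V]

/-- Paths with boundedly many stamps. -/
def Valid (P : V → List ℤ) : Prop :=
  PrefixClosed P ∧ ∀ q, ∀ s ∈ P q, -(Fintype.card V : ℤ) < s ∧ s ≤ 0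

theorem valid_compress {P : V → List ℤ} (hP : PrefixClosed P) : Valid (compress P) := by
  refine ⟨prefixClosed_relabel hP _, fun q s hs => ?_⟩
  obtain ⟨u, hu, rfl⟩ := List.mem_map.1 hs
  have := (idx_lt_card (mem_stamps.2 ⟨q, hu⟩)).trans_le (card_stamps_le hP)
  omega

/-- A path is determined by the path of its parent and its last stamp. -/
theorem exists_code {P : V → List ℤ} (hP : Valid P) (q : V) :
    ∃ c : Option (Option V × Fin (Fintype.card V)),
      match c with
      | none => P q = []
      | some (none, i) => P q = [-(i : ℤ)]
      | some (some p, i) => P q = P p ++ [-(i : ℤ)] := by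
  rcases List.eq_nil_or_concat (P q) with h | ⟨l, s, h⟩
  · exact ⟨none, h⟩
  · have hs := hP.2 q s (by simp [h])
    have hi : s = -(((⟨s.natAbs, by omega⟩ : Fin (Fintype.card V)) : ℕ) : ℤ) := by
      simp only
      omega
    by_cases hl : l = []
    · refine ⟨some (none, ⟨s.natAbs, by omega⟩), ?_⟩
      simp only
      rw [h, hl, ← hi]; rfl
    · obtain ⟨p, hp⟩ := hP.1 q l hl (by rw [h]; simp)
      refine ⟨some (some p, ⟨s.natAbs, by omega⟩), ?_⟩
      simp only
      rw [h, hp, ← hi, List.concat_eq_append]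

noncomputable def code (P : {P : V → List ℤ // Valid P}) (q : V) :
    Option (Option V × Fin (Fintype.card V)) :=
  (exists_code P.2 q).choose

/-- Induction on path length: equal codes name the same parent state and the same last stamp, and
the parent's path is shorter. -/
theorem code_injective : Function.Injective (code (V := V)) := by
  intro P P' h
  have key : ∀ k q, (P.1 q).length ≤ k → P.1 q = P'.1 q := by
    intro k
    induction k with
    | zero =>
      intro q hq
      have h1 := (exists_code P.2 q).choose_spec
      have h2 := (exists_code P'.2 q).choose_spec
      have h3 := congrFun h q
      unfold code at h3
      rw [← h3] at h2
      revert h1 h2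
      rcases (exists_code P.2 q).choose with _ | ⟨_ | p, i⟩
      · exact fun h1 h2 => h1.trans h2.symm
      · exact fun h1 h2 => h1.trans h2.symm
      · intro h1
        rw [h1] at hq
        simp at hq
    | succ k ih =>
      intro q hq
      have h1 := (exists_code P.2 q).choose_spec
      have h2 := (exists_code P'.2 q).choose_spec
      have h3 := congrFun h q
      unfold code at h3
      rw [← h3] at h2
      revert h1 h2
      rcases (exists_code P.2 q).choose with _ | ⟨_ | p, i⟩
      · exact fun h1 h2 => h1.trans h2.symm
      · exact fun h1 h2 => h1.trans h2.symm
      · intro h1 h2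
        simp only at h1 h2
        rw [h1] at hq
        rw [h1, h2, ih p (by simpa using hq)]
  exact Subtype.ext (funext fun q => key _ q le_rfl)

/-- States of the deterministic automaton: the paths, the ranks of the nodes that were good, and
the ranks that were unstable in the last step. -/
abbrev State (V : Type) [Fintype V] : Type :=
  {P : V → List ℤ // Valid P} × Set (Fin (Fintype.card V)) × Set (Fin (Fintype.card V))

noncomputable instance : Fintype {P : V → List ℤ // Valid P} :=
  open Classical in Fintype.ofInjective code code_injective

open Classical in
theorem card_state_le :
    Fintype.card (State V) ≤ (Fintype.card V + 1) ^ (4 * Fintype.card V) := by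
  have h1 := Fintype.card_le_of_injective _ (code_injective (V := V))
  rw [Fintype.card_fun, Fintype.card_option, Fintype.card_prod, Fintype.card_option,
    Fintype.card_fin] at h1
  rw [Fintype.card_prod, Fintype.card_prod, Fintype.card_set, Fintype.card_fin]
  set n := Fintype.card V
  -- The estimate `2 ≤ n + 1` for the two sets of ranks needs `n` positive.
  rcases Nat.eq_zero_or_pos n with hn | hn
  · simp only [hn, pow_zero, mul_zero, mul_one] at h1 ⊢
    exact h1
  · calc _ ≤ ((n + 1) * n + 1) ^ n * (2 ^ n * 2 ^ n) := Nat.mul_le_mul_right _ h1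
      _ ≤ ((n + 1) ^ 2) ^ n * ((n + 1) ^ n * (n + 1) ^ n) := by
        gcongr <;> nlinarith
      _ = (n + 1) ^ (4 * n) := by
        rw [← pow_mul, ← pow_add, ← pow_add]; congr 1; ring

/-! ### The deterministic run -/

/-- The two sets of ranks describe the step just taken, because Rabin acceptance looks at locations
and not at transitions. -/
noncomputable def next (F : Set V) (σ : State V) (L : V → V → Prop) : State V :=
  (⟨compress (step (-(Fintype.card V : ℤ)) L F σ.1.1), valid_compress (prefixClosed_trunc _)⟩,
    {i | Good (-(Fintype.card V : ℤ)) L F σ.1.1 i}, {i | Bad (-(Fintype.card V : ℤ)) L F σ.1.1 i})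

/-- Paths at time `0` depend neither on the accepting set nor on the input, so both are dummies. -/
noncomputable def start (I : Set V) : State V :=
  (⟨compress (track I ∅ (fun _ _ _ => True) 0), valid_compress (prefixClosed_track 0)⟩, ∅, ∅)

/-- The run of the deterministic automaton. -/
noncomputable def run (I F : Set V) (w : ℕ → V → V → Prop) : ℕ → State V
  | 0 => start I
  | t + 1 => next F (run I F w t) (w t)

/-- Compression is an increasing relabelling, so compressing before a step or only after it gives
the same ranks. -/
theorem run_fst (I F : Set V) (w : ℕ → V → V → Prop) (t : ℕ) :
    (run I F w t).1.1 = compress (track I F w t) := by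
  induction t with
  | zero => rfl
  | succ t ih =>
    obtain ⟨g, hg, hgP, hgf⟩ := exists_relabel_eq_compress (prefixClosed_track (I := I) (F := F)
      (w := w) t) (fun s hs => fresh_lt hs)
    change compress (step _ _ _ (run I F w t).1.1) = compress (step _ _ _ _)
    rw [ih, ← hgf, ← hgP, step_relabel hg, compress_relabel (hg.mono ?_)]
    exact Finset.coe_subset.2 (stamps_step_subset _ _ _ _)

theorem mem_run_good {I F : Set V} {w : ℕ → V → V → Prop} {t : ℕ}
    {i : Fin (Fintype.card V)} : i ∈ (run I F w (t + 1)).2.1 ↔ GoodRankAt I F w i t := by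
  obtain ⟨g, hg, hgP, hgf⟩ := exists_relabel_eq_compress (prefixClosed_track (I := I) (F := F)
    (w := w) t) (fun s hs => fresh_lt hs)
  change Good _ _ _ (run I F w t).1.1 i ↔ _
  rw [run_fst, ← hgf, ← hgP, good_relabel hg, GoodRankAt]

theorem mem_run_bad {I F : Set V} {w : ℕ → V → V → Prop} {t : ℕ}
    {i : Fin (Fintype.card V)} : i ∈ (run I F w (t + 1)).2.2 ↔ BadAt I F w i t := by
  obtain ⟨g, hg, hgP, hgf⟩ := exists_relabel_eq_compress (prefixClosed_track (I := I) (F := F)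
    (w := w) t) (fun s hs => fresh_lt hs)
  change Bad _ _ _ (run I F w t).1.1 i ↔ _
  rw [run_fst, ← hgf, ← hgP, bad_relabel hg, BadAt]

open Classical in
noncomputable def pairs (V : Type) [Fintype V] : Finset (Set (State V) × Set (State V)) :=
  Finset.univ.image fun i : Fin (Fintype.card V) => ({σ | i ∈ σ.2.1}, {σ | i ∈ σ.2.2})

theorem card_pairs_le : (pairs V).card ≤ Fintype.card V :=
  Finset.card_image_le.trans (by simp)

/-- Determinization: the deterministic Rabin automaton accepts the words that have a Büchi
accepting run. -/
theorem exists_run_iff (I F : Set V) (w : ℕ → V → V → Prop) :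
    (∃ ρ : ℕ → V, ρ 0 ∈ I ∧ (∀ t, w t (ρ t) (ρ (t + 1))) ∧ ∃ᶠ t in atTop, ρ t ∈ F) ↔
      ∃ p ∈ pairs V, (∃ᶠ t in atTop, run I F w t ∈ p.1) ∧ ∀ᶠ t in atTop, run I F w t ∉ p.2 := by
  have hshift : ∀ A : Set (State V), (∃ᶠ t in atTop, run I F w (t + 1) ∈ A) ↔
      ∃ᶠ t in atTop, run I F w t ∈ A := fun A => by
    rw [← Filter.frequently_map (m := fun t : ℕ => t + 1) (P := fun t => run I F w t ∈ A),
      map_add_atTop_eq_nat]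
  have hiff : (∃ p ∈ pairs V, (∃ᶠ t in atTop, run I F w t ∈ p.1) ∧
      ∀ᶠ t in atTop, run I F w t ∉ p.2) ↔ ∃ i : Fin (Fintype.card V),
        (∃ᶠ t in atTop, GoodRankAt I F w i t) ∧ ∀ᶠ t in atTop, ¬ BadAt I F w i t := by
    simp only [pairs, Finset.mem_image, Finset.mem_univ, true_and, exists_exists_eq_and,
      ← not_frequently, ← hshift]
    simp only [Set.mem_ofPred_eq, mem_run_good, mem_run_bad, not_frequently]
  rw [hiff]
  constructor
  · rintro ⟨ρ, h0, hρ, hF⟩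
    obtain ⟨v, hv⟩ := exists_good_of_run h0 hρ hF
    obtain ⟨i, hi, h⟩ := exists_rank_of_good hv
    exact ⟨⟨i, hi⟩, h⟩
  · rintro ⟨i, h1, h2⟩
    obtain ⟨v, hv⟩ := exists_good_of_rank h1 h2
    exact exists_run_of_good hv

end Safra

namespace WordConstraint

/-! ### Types -/

section

variable {β : ℕ}

theorem holds_conjList {z z' : Fin β → ℤ} {l : List (Constraint β)} :
    (conjList l).Holds z z' ↔ ∀ θ ∈ l, θ.Holds z z' := by
  induction l with
  | nil => simp [conjList, Constraint.Holds]
  | cons θ l ih =>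
    cases l with
    | nil => simp [conjList]
    | cons θ' l => rw [conjList, Constraint.Holds, ih, List.forall_mem_cons (a := θ)]

theorem holds_typeConstraint {lo hi : ℤ} {cst : Fin (β + β) → ConstRel}
    {rel : Fin (β + β) → Fin (β + β) → Ordering} {z z' : Fin β → ℤ} :
    (typeConstraint lo hi cst rel).Holds z z' ↔
      (∀ i, ((cst i).toConstraint lo hi (termAt i)).Holds z z') ∧
      ∀ i j, i < j → (orderConstraint (termAt i) (termAt j) (rel i j)).Holds z z' := by
  simp only [typeConstraint, Constraint.Holds, holds_conjList, List.forall_mem_map, SProd.sprod,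
    List.mem_filter, decide_eq_true_eq, List.mem_finRange, true_imp_iff, Prod.forall,
    List.pair_mem_product, true_and]

theorem typeConstraint_congr {lo hi : ℤ} {cst cst' : Fin (β + β) → ConstRel}
    {rel rel' : Fin (β + β) → Fin (β + β) → Ordering} (hcst : ∀ i, cst i = cst' i)
    (hrel : ∀ i j, i < j → rel i j = rel' i j) :
    typeConstraint lo hi cst rel = typeConstraint lo hi cst' rel' := by
  rw [funext hcst, typeConstraint, typeConstraint]
  congr 2
  refine List.map_congr_left fun p hp => ?_
  rw [hrel p.1 p.2 (by simpa using (List.mem_filter.1 hp).2)]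

/-- The relation of an integer with the constants. -/
def constRelOf (lo hi v : ℤ) : ConstRel :=
  if v < lo then .below else if hi < v then .above else .equal v

/-- The type of a pair of valuations. -/
def typeOf (lo hi : ℤ) (z z' : Fin β → ℤ) : Constraint β :=
  typeConstraint lo hi (fun i => constRelOf lo hi ((termAt i).val z z'))
    fun i j => compare ((termAt i).val z z') ((termAt j).val z z')

theorem holds_orderConstraint {z z' : Fin β → ℤ} {s t : Term β} {o : Ordering} :
    (orderConstraint s t o).Holds z z' ↔ compare (s.val z z') (t.val z z') = o := by
  cases o
  · rw [compare_lt_iff_lt]; rfl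
  · rw [compare_eq_iff_eq]; rfl
  · rw [compare_gt_iff_gt]; rfl

theorem holds_toConstraint {lo hi : ℤ} (hlo : lo ≤ hi) {z z' : Fin β → ℤ} {t : Term β}
    {r : ConstRel} (hr : ∀ d, r = .equal d → lo ≤ d ∧ d ≤ hi) :
    (r.toConstraint lo hi t).Holds z z' ↔ constRelOf lo hi (t.val z z') = r := by
  unfold constRelOf
  cases r with
  | below => simp only [ConstRel.toConstraint, Constraint.Holds]; split_ifs <;> simp_all
  | above =>
    simp only [ConstRel.toConstraint, Constraint.Holds]
    split_ifs with h1 h2 <;> simp_all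
    omega
  | equal d =>
    have := hr d rfl
    simp only [ConstRel.toConstraint, Constraint.Holds]
    split_ifs with h1 h2
    · simp only [iff_false]; omega
    · simp only [iff_false]; omega
    · simp

theorem constRelOf_eq_equal {lo hi v d : ℤ} (h : constRelOf lo hi v = .equal d) :
    lo ≤ d ∧ d ≤ hi := by
  unfold constRelOf at h
  split_ifs at h
  cases h
  omega

theorem holds_typeOf {lo hi : ℤ} (hlo : lo ≤ hi) (z z' : Fin β → ℤ) :
    (typeOf lo hi z z').Holds z z' :=
  holds_typeConstraint.2 ⟨fun _ => (holds_toConstraint hlo fun _ => constRelOf_eq_equal).2 rfl,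
    fun _ _ _ => holds_orderConstraint.2 rfl⟩

theorem isType_typeOf (lo hi : ℤ) (z z' : Fin β → ℤ) : IsType lo hi (typeOf lo hi z z') :=
  ⟨_, _, fun _ _ => constRelOf_eq_equal, rfl⟩

theorem typeOf_mem_satTypes {lo hi : ℤ} (hlo : lo ≤ hi) (z z' : Fin β → ℤ) :
    typeOf lo hi z z' ∈ SatTypes β lo hi :=
  ⟨isType_typeOf lo hi z z', z, z', holds_typeOf hlo z z'⟩

/-- A pair of valuations satisfies at most one type. -/
theorem IsType.eq_typeOf {lo hi : ℤ} (hlo : lo ≤ hi) {θ : Constraint β} (hθ : IsType lo hi θ)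
    {z z' : Fin β → ℤ} (h : θ.Holds z z') : θ = typeOf lo hi z z' := by
  obtain ⟨cst, rel, hcst, rfl⟩ := hθ
  rw [holds_typeConstraint] at h
  exact typeConstraint_congr (fun i => ((holds_toConstraint hlo (hcst i)).1 (h.1 i)).symm)
    fun i j hij => (holds_orderConstraint.1 (h.2 i j hij)).symm

theorem exists_termAt (t : Term β) : ∃ k, termAt k = t := by
  cases t with
  | cur i => exact ⟨finSumFinEquiv (Sum.inl i), by rw [termAt, Equiv.symm_apply_apply]; rfl⟩
  | nxt i => exact ⟨finSumFinEquiv (Sum.inr i), by rw [termAt, Equiv.symm_apply_apply]; rfl⟩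

theorem lt_iff_of_compare_eq {a b c d : ℤ} (h : compare a b = compare c d) : a < b ↔ c < d := by
  rw [← compare_lt_iff_lt, h, compare_lt_iff_lt]

/-- Types determine the truth values of all constraints whose constants lie between `lo`
and `hi`. -/
theorem holds_iff_of_holds_typeOf {lo hi : ℤ} (hlo : lo ≤ hi) {y y' z z' : Fin β → ℤ}
    (h : (typeOf lo hi y y').Holds z z') {θ : Constraint β}
    (hθ : ∀ d ∈ θ.consts, lo ≤ d ∧ d ≤ hi) : θ.Holds z z' ↔ θ.Holds y y' := by
  rw [typeOf, holds_typeConstraint] at h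
  have hc : ∀ t : Term β, constRelOf lo hi (t.val z z') = constRelOf lo hi (t.val y y') := by
    intro t
    obtain ⟨k, rfl⟩ := exists_termAt t
    exact (holds_toConstraint hlo fun _ => constRelOf_eq_equal).1 (h.1 k)
  have hconst : ∀ (t : Term β) (d : ℤ), lo ≤ d ∧ d ≤ hi →
      (t.val z z' < d ↔ t.val y y' < d) ∧ (d < t.val z z' ↔ d < t.val y y') := by
    intro t d hd
    have := hc t
    -- Both values are below `lo`, both above `hi`, or they are equal; each case fixes the
    -- comparison with `d` in the range.
    unfold constRelOf at this
    split_ifs at this <;> first | (constructor <;> omega) | skip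
    rw [ConstRel.equal.injEq] at this
    simp [this]
  have ho : ∀ s t : Term β, s.val z z' < t.val z z' ↔ s.val y y' < t.val y y' := by
    intro s t
    obtain ⟨i, rfl⟩ := exists_termAt s
    obtain ⟨j, rfl⟩ := exists_termAt t
    rcases lt_trichotomy i j with hij | rfl | hij
    · exact lt_iff_of_compare_eq (holds_orderConstraint.1 (h.2 i j hij))
    · simp
    · have := holds_orderConstraint.1 (h.2 j i hij)
      rw [← compare_gt_iff_gt, this, compare_gt_iff_gt]
  have heq : ∀ {a b c d : ℤ}, (a < b ↔ c < d) → (b < a ↔ d < c) → (a = b ↔ c = d) := by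
    intros; omega
  induction θ with
  | tru => rfl
  | lt s t => exact ho s t
  | eq s t => exact heq (ho s t) (ho t s)
  | eqConst t d =>
    have := hconst t d (hθ d (by simp [Constraint.consts]))
    exact heq this.1 this.2
  | ltConst t d => exact (hconst t d (hθ d (by simp [Constraint.consts]))).1
  | gtConst t d => exact (hconst t d (hθ d (by simp [Constraint.consts]))).2
  | neg θ ih => exact not_congr (ih hθ)
  | conj θ₁ θ₂ ih₁ ih₂ =>
    simp only [Constraint.consts, Finset.mem_union] at hθ
    exact and_congr (ih₁ fun d hd => hθ d (Or.inl hd)) (ih₂ fun d hd => hθ d (Or.inr hd))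
  | disj θ₁ θ₂ ih₁ ih₂ =>
    simp only [Constraint.consts, Finset.mem_union] at hθ
    exact or_congr (ih₁ fun d hd => hθ d (Or.inl hd)) (ih₂ fun d hd => hθ d (Or.inr hd))

/-! ### Size of types -/

theorem size_conjList_le {l : List (Constraint β)} {B : ℕ} (h : ∀ θ ∈ l, θ.size ≤ B) :
    (conjList l).size ≤ 1 + l.length * (B + 1) := by
  induction l with
  | nil => simp [conjList, Constraint.size]
  | cons θ l ih =>
    rw [List.forall_mem_cons] at h
    cases l with
    | nil => simp only [conjList, List.length_singleton]; omega
    | cons θ' l =>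
      have := ih h.2
      rw [conjList, Constraint.size, List.length_cons, add_mul]
      omega

theorem natSize_le (n : ℕ) : Nat.size n ≤ n := Nat.size_le.2 Nat.lt_two_pow_self

theorem size_term_le (t : Term β) : t.size ≤ 2 + β := by
  cases t with
  | cur i => have := natSize_le (i + 1); simp only [Term.size]; omega
  | nxt i => have := natSize_le (i + 1); simp only [Term.size]; omega

theorem intSize_le {lo hi d : ℤ} (h₁ : lo ≤ d) (h₂ : d ≤ hi) :
    intSize d ≤ max (Nat.clog 2 lo.natAbs) (Nat.clog 2 hi.natAbs) + 2 := by
  have h : d.natAbs ≤ max lo.natAbs hi.natAbs := by omega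
  -- Powers of two need one digit more than their logarithm; the sign accounts for the other unit.
  have key : ∀ n : ℕ, Nat.size n ≤ Nat.clog 2 n + 1 := fun n =>
    Nat.size_le.2 ((Nat.le_pow_clog one_lt_two n).trans_lt
      (Nat.pow_lt_pow_right one_lt_two (Nat.lt_succ_self _)))
  rw [intSize]
  rcases le_max_iff.1 h with h | h
  · have h1 := Nat.size_le_size h
    have h2 := key lo.natAbs
    omega
  · have h1 := Nat.size_le_size h
    have h2 := key hi.natAbs
    omega

/-- There are `2β` comparisons with constants, linear in `β + m`, and at most `4β²` order conjuncts,
linear in `β`. The coefficients `3 + 14 + 32` fit under `50`. -/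
theorem IsType.size_le {lo hi : ℤ} (hlo : lo ≤ hi) (hβ : 1 ≤ β) {θ : Constraint β}
    (hθ : IsType lo hi θ) :
    θ.size ≤ 50 * (β + max (Nat.clog 2 lo.natAbs) (Nat.clog 2 hi.natAbs)) ^ 3 := by
  obtain ⟨cst, rel, hcst, rfl⟩ := hθ
  set m := max (Nat.clog 2 lo.natAbs) (Nat.clog 2 hi.natAbs) with hm
  have h1 : ∀ θ ∈ (List.finRange (β + β)).map fun i => (cst i).toConstraint lo hi (termAt i),
      θ.size ≤ 5 + β + m := by
    simp only [List.mem_map, List.mem_finRange, true_and, forall_exists_index]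
    rintro θ i rfl
    have ht := size_term_le (termAt i)
    cases hi : cst i with
    | below =>
      have := intSize_le le_rfl hlo
      simp only [ConstRel.toConstraint, Constraint.size]; omega
    | above =>
      have := intSize_le hlo le_rfl
      simp only [ConstRel.toConstraint, Constraint.size]; omega
    | equal d =>
      have := intSize_le (hcst i d hi).1 (hcst i d hi).2
      simp only [ConstRel.toConstraint, Constraint.size]; omega
  have h2 : ∀ θ ∈ ((List.finRange (β + β) ×ˢ List.finRange (β + β)).filter
      fun p => p.1 < p.2).map fun p => orderConstraint (termAt p.1) (termAt p.2) (rel p.1 p.2),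
      θ.size ≤ 5 + 2 * β := by
    intro θ hθ
    obtain ⟨p, -, rfl⟩ := List.mem_map.1 hθ
    have hs := size_term_le (termAt p.1)
    have ht := size_term_le (termAt p.2)
    cases rel p.1 p.2 <;> simp only [orderConstraint, Constraint.size] <;> omega
  have h3 := size_conjList_le h1
  have h4 := size_conjList_le h2
  have h5 : (((List.finRange (β + β) ×ˢ List.finRange (β + β)).filter
      fun p => p.1 < p.2).map fun p =>
        orderConstraint (termAt p.1) (termAt p.2) (rel p.1 p.2)).length ≤ 4 * β ^ 2 := by
    rw [List.length_map]
    refine (List.length_filter_le _ _).trans ?_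
    rw [List.length_product, List.length_finRange]
    exact le_of_eq (by ring)
  rw [List.length_map, List.length_finRange] at h3
  rw [typeConstraint, Constraint.size]
  have h6 := h4.trans (Nat.add_le_add_left (Nat.mul_le_mul_right _ h5) 1)
  refine (Nat.add_le_add (Nat.add_le_add_right h3 1) h6).trans ?_
  obtain ⟨D, hD⟩ : ∃ D, D = β + m := ⟨_, rfl⟩
  rw [← hD]
  have hβD : β ≤ D := by omega
  have hD1 : 1 ≤ D := by omega
  calc 1 + (β + β) * (5 + β + m + 1) + 1 + (1 + 4 * β ^ 2 * (5 + 2 * β + 1))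
      ≤ 1 + (D + D) * (7 * D) + 1 + (1 + 4 * D ^ 2 * (8 * D)) := by gcongr <;> omega
    _ = 3 * 1 + 14 * D ^ 2 + 32 * D ^ 3 := by ring
    _ ≤ 3 * D ^ 3 + 14 * D ^ 3 + 32 * D ^ 3 := by
      gcongr
      · exact Nat.one_le_pow _ _ hD1
      · omega
    _ ≤ 50 * D ^ 3 := by omega

/-! ### Number of types -/

/-- Increasing pairs and their swaps are disjoint sets of pairs. -/
theorem two_mul_card_lt_le (m : ℕ) :
    2 * Fintype.card {p : Fin m × Fin m // p.1 < p.2} ≤ m * m := by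
  have := Fintype.card_le_of_injective
    (Sum.elim (fun p : {p : Fin m × Fin m // p.1 < p.2} => p.1)
      fun p : {p : Fin m × Fin m // p.1 < p.2} => p.1.swap) (by
    refine Function.Injective.sumElim Subtype.val_injective
      (Prod.swap_injective.comp Subtype.val_injective) ?_
    rintro ⟨a, ha⟩ ⟨b, hb⟩ rfl
    exact lt_asymm ha hb)
  rw [Fintype.card_sum, Fintype.card_prod, Fintype.card_fin] at this
  omega

/-- The relations with the constants, numbered. -/
def constRelAt (lo : ℤ) (k : ℕ) : ConstRel :=
  if k = 0 then .below else if k = 1 then .above else .equal (lo + k - 2)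

open Classical in
/-- The satisfiable types. -/
noncomputable def satTypes (β : ℕ) (lo hi : ℤ) : Finset (Constraint β) :=
  (Finset.univ.image fun c : (Fin (β + β) → Fin (hi - lo + 3).toNat) ×
      ({p : Fin (β + β) × Fin (β + β) // p.1 < p.2} → Ordering) =>
    typeConstraint lo hi (fun i => constRelAt lo (c.1 i))
      fun i j => if h : i < j then c.2 ⟨(i, j), h⟩ else .eq).filter (· ∈ SatTypes β lo hi)

theorem mem_satTypes {lo hi : ℤ} (hlo : lo ≤ hi) {θ : Constraint β} :
    θ ∈ satTypes β lo hi ↔ θ ∈ SatTypes β lo hi := by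
  simp only [satTypes, Finset.mem_filter, and_iff_right_iff_imp, Finset.mem_image,
    Finset.mem_univ, true_and]
  rintro ⟨⟨cst, rel, hcst, rfl⟩, -⟩
  have : ∀ i, ∃ k : Fin (hi - lo + 3).toNat, constRelAt lo k = cst i := by
    intro i
    cases h : cst i with
    | below => exact ⟨⟨0, by omega⟩, rfl⟩
    | above => exact ⟨⟨1, by omega⟩, rfl⟩
    | equal d =>
      have := hcst i d h
      -- Numbers `0` and `1` stand for below and above, so the constants start at `2`.
      refine ⟨⟨(d - lo + 2).toNat, by omega⟩, ?_⟩
      simp only [constRelAt]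
      rw [if_neg (by omega), if_neg (by omega)]
      congr 1
      omega
  choose c hc using this
  exact ⟨(c, fun p => rel p.1.1 p.1.2), typeConstraint_congr hc fun i j hij => by simp [hij]⟩

theorem card_satTypes_le {lo hi : ℤ} (hlo : lo ≤ hi) :
    ((satTypes β lo hi).card : ℤ) ≤ ((hi - lo) + 3) ^ (2 * β) * 3 ^ (2 * β ^ 2) := by
  classical
  have h1 : (satTypes β lo hi).card ≤ (hi - lo + 3).toNat ^ (2 * β) * 3 ^ (2 * β ^ 2) := by
    refine (Finset.card_filter_le _ _).trans (Finset.card_image_le.trans ?_)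
    rw [Finset.card_univ, Fintype.card_prod, Fintype.card_fun, Fintype.card_fun,
      Fintype.card_fin, Fintype.card_fin, two_mul]
    refine Nat.mul_le_mul_left _ ?_
    rw [show Fintype.card Ordering = 3 from rfl]
    refine Nat.pow_le_pow_right (by omega) ?_
    have := two_mul_card_lt_le (β + β)
    nlinarith
  have h2 : (((hi - lo + 3).toNat : ℕ) : ℤ) = hi - lo + 3 := Int.toNat_of_nonneg (by omega)
  rw [← h2]
  exact_mod_cast h1

end

open Filter

/-! ### The deterministic automaton -/

/-- With finitely many locations, visiting `S` infinitely often means visiting one of its elements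
infinitely often. -/
theorem infLoc_inter_nonempty_iff {Q A : Type*} [Finite Q] {β : ℕ} {ρ : ℕ → Transition Q A β}
    {S : Set Q} : (infLoc ρ ∩ S).Nonempty ↔ ∃ᶠ n in atTop, (ρ n).src ∈ S := by
  constructor
  · rintro ⟨q, hq, hS⟩
    exact (Nat.frequently_atTop_iff_infinite.2 hq).mono fun n hn => by rwa [hn]
  · intro h
    by_contra hno
    have : ∀ᶠ n in atTop, ∀ q : S, (ρ n).src ≠ q := eventually_all.2 fun q => by
      by_contra hq
      exact hno ⟨q, Nat.frequently_atTop_iff_infinite.1 (by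
        simpa only [Filter.Frequently, Ne] using hq), q.2⟩
    obtain ⟨n, h1, h2⟩ := (h.and_eventually this).exists
    exact h2 ⟨_, h1⟩ rfl

variable {Q A : Type*} {β : ℕ}

/-- The moves of `M` with the letter `a` that are compatible with the type `θ`, on numbered
locations. -/
def letterRel {V : Type} (e : Q ≃ V) (M : Automaton Q A β) (a : A) (θ : Constraint β) (p q : V) :
    Prop :=
  ∃ τ ∈ M.trans, e τ.src = p ∧ τ.letter = a ∧ e τ.tgt = q ∧
    ∃ z z', θ.Holds z z' ∧ τ.guard.Holds z z'

/-- All pairs of valuations of one type satisfy the same guards, so the witnesses in `letterRel` may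
be replaced by `z`, `z'`. -/
theorem letterRel_typeOf_iff {V : Type} {e : Q ≃ V} {M : Automaton Q A β} {a : A} {lo hi : ℤ}
    (hlo : lo ≤ hi) (hM : ∀ d ∈ M.consts, lo ≤ d ∧ d ≤ hi) {z z' : Fin β → ℤ} {p q : V} :
    letterRel e M a (typeOf lo hi z z') p q ↔
      ∃ τ ∈ M.trans, e τ.src = p ∧ τ.letter = a ∧ e τ.tgt = q ∧ τ.guard.Holds z z' := by
  constructor
  · rintro ⟨τ, hτ, h1, h2, h3, y, y', hy, hg⟩
    exact ⟨τ, hτ, h1, h2, h3,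
      (holds_iff_of_holds_typeOf hlo hy fun d hd => hM d ⟨τ, hτ, hd⟩).1 hg⟩
  · rintro ⟨τ, hτ, h1, h2, h3, hg⟩
    exact ⟨τ, hτ, h1, h2, h3, z, z', holds_typeOf hlo z z', hg⟩

variable [Fintype A] {V : Type} [Fintype V]

open Classical in
/-- The deterministic Rabin automaton that reads letters and types. -/
noncomputable def determinize (e : Q ≃ V) (M : BuchiAutomaton Q A β) (lo hi : ℤ) :
    RabinAutomaton (Safra.State V) A β where
  init := {Safra.start (e '' M.init)}
  trans := (Finset.univ ×ˢ Finset.univ ×ˢ satTypes β lo hi).image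
    fun x : Safra.State V × A × Constraint β =>
      ⟨x.1, x.2.1, x.2.2,
        Safra.next (e '' M.acc) x.1 (letterRel e M.toAutomaton x.2.1 x.2.2)⟩
  pairs := Safra.pairs V

variable {e : Q ≃ V} {M : BuchiAutomaton Q A β} {lo hi : ℤ}

theorem mem_trans_determinize (hlo : lo ≤ hi) {τ : Transition (Safra.State V) A β} :
    τ ∈ (determinize e M lo hi).trans ↔ τ.guard ∈ SatTypes β lo hi ∧
      τ.tgt = Safra.next (e '' M.acc) τ.src (letterRel e M.toAutomaton τ.letter τ.guard) := by
  simp only [determinize, Finset.mem_image, Finset.mem_product, Finset.mem_univ, true_and,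
    mem_satTypes hlo]
  constructor
  · rintro ⟨x, hx, rfl⟩
    exact ⟨hx, rfl⟩
  · rintro ⟨h1, h2⟩
    refine ⟨(τ.src, τ.letter, τ.guard), h1, ?_⟩
    simp only
    rw [← h2]

/-- The valuations select a single type, and the target is a function of source, letter and type. -/
theorem deterministic_determinize (hlo : lo ≤ hi) :
    (determinize e M lo hi).Deterministic := by
  rintro q a z z' ⟨s₁, a₁, θ₁, t₁⟩ h₁ ⟨s₂, a₂, θ₂, t₂⟩ h₂ rfl rfl hg₁ rfl rfl hg₂
  rw [mem_trans_determinize hlo] at h₁ h₂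
  obtain ⟨hθ₁, ht₁⟩ := h₁
  obtain ⟨hθ₂, ht₂⟩ := h₂
  obtain rfl : θ₁ = θ₂ :=
    (hθ₁.1.eq_typeOf hlo hg₁).trans (hθ₂.1.eq_typeOf hlo hg₂).symm
  rw [Transition.mk.injEq]
  exact ⟨rfl, rfl, rfl, ht₁.trans ht₂.symm⟩

theorem card_trans_determinize_le (hlo : lo ≤ hi) :
    ((determinize e M lo hi).trans.card : ℤ) ≤ (Fintype.card (Safra.State V) : ℤ) ^ 2 *
      (Fintype.card A : ℤ) * ((hi - lo) + 3) ^ (2 * β) * 3 ^ (2 * β ^ 2) := by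
  classical
  have h1 : (determinize e M lo hi).trans.card ≤
      Fintype.card (Safra.State V) * (Fintype.card A * (satTypes β lo hi).card) := by
    refine Finset.card_image_le.trans (le_of_eq ?_)
    rw [Finset.card_product, Finset.card_product, Finset.card_univ, Finset.card_univ]
  have h2 : Fintype.card (Safra.State V) ≤ Fintype.card (Safra.State V) ^ 2 :=
    Nat.le_self_pow two_ne_zero _
  calc ((determinize e M lo hi).trans.card : ℤ)
      ≤ (Fintype.card (Safra.State V) : ℤ) * ((Fintype.card A : ℤ) * (satTypes β lo hi).card) := by
        exact_mod_cast h1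
    _ ≤ (Fintype.card (Safra.State V) : ℤ) ^ 2 *
        ((Fintype.card A : ℤ) * (((hi - lo) + 3) ^ (2 * β) * 3 ^ (2 * β ^ 2))) := by
      gcongr
      · exact_mod_cast h2
      · exact card_satTypes_le hlo
    _ = _ := by ring

/-- The word of moves that `M` can make along a data word. -/
noncomputable def moves (e : Q ≃ V) (M : Automaton Q A β) (lo hi : ℤ) (w : ℕ → A × (Fin β → ℤ))
    (n : ℕ) : V → V → Prop :=
  letterRel e M (w n).1 (typeOf lo hi (w n).2 (w (n + 1)).2)

/-- Satisfiable types cover all valuations, so each data word has exactly one initialized run. -/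
theorem isInitRun_determinize_iff (hlo : lo ≤ hi) {w : ℕ → A × (Fin β → ℤ)}
    {ρ : ℕ → Transition (Safra.State V) A β} :
    (determinize e M lo hi).IsInitRun w ρ ↔ ∀ n, ρ n =
      ⟨Safra.run (e '' M.init) (e '' M.acc) (moves e M.toAutomaton lo hi w) n, (w n).1,
        typeOf lo hi (w n).2 (w (n + 1)).2,
        Safra.run (e '' M.init) (e '' M.acc) (moves e M.toAutomaton lo hi w) (n + 1)⟩ := by
  constructor
  · intro h
    have hguard : ∀ n, (ρ n).guard = typeOf lo hi (w n).2 (w (n + 1)).2 := fun n =>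
      ((mem_trans_determinize hlo).1 (h.mem n)).1.1.eq_typeOf hlo (h.guard n)
    have htgt : ∀ n, (ρ n).tgt = Safra.next (e '' M.acc) (ρ n).src
        (moves e M.toAutomaton lo hi w n) := fun n => by
      rw [((mem_trans_determinize hlo).1 (h.mem n)).2, hguard, h.letter]; rfl
    have hsrc : ∀ n, (ρ n).src =
        Safra.run (e '' M.init) (e '' M.acc) (moves e M.toAutomaton lo hi w) n := by
      intro n
      induction n with
      | zero => exact h.init
      | succ n ih => rw [h.step, htgt, ih]; rfl
    intro n
    have ht := htgt n
    rw [hsrc n] at ht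
    rw [← hsrc n, ← h.letter n, ← hguard n]
    exact congrArg (Transition.mk (ρ n).src (ρ n).letter (ρ n).guard) ht
  · intro h
    refine ⟨?_, fun n => ?_, fun n => ?_, fun n => ?_, fun n => ?_⟩
    · rw [h]; rfl
    · rw [h, mem_trans_determinize hlo]
      exact ⟨typeOf_mem_satTypes hlo _ _, rfl⟩
    · rw [h]
    · rw [h, h]
    · rw [h]; exact holds_typeOf hlo _ _

theorem mem_lang_determinize_iff (hlo : lo ≤ hi) {w : ℕ → A × (Fin β → ℤ)} :
    w ∈ (determinize e M lo hi).lang ↔ ∃ p ∈ Safra.pairs V,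
      (∃ᶠ t in atTop,
        Safra.run (e '' M.init) (e '' M.acc) (moves e M.toAutomaton lo hi w) t ∈ p.1) ∧
      ∀ᶠ t in atTop,
        Safra.run (e '' M.init) (e '' M.acc) (moves e M.toAutomaton lo hi w) t ∉ p.2 := by
  have key : ∀ {ρ}, (determinize e M lo hi).IsInitRun w ρ → ((∃ p ∈ Safra.pairs V,
      (infLoc ρ ∩ p.1).Nonempty ∧ infLoc ρ ∩ p.2 = ∅) ↔ ∃ p ∈ Safra.pairs V,
      (∃ᶠ t in atTop,
        Safra.run (e '' M.init) (e '' M.acc) (moves e M.toAutomaton lo hi w) t ∈ p.1) ∧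
      ∀ᶠ t in atTop,
        Safra.run (e '' M.init) (e '' M.acc) (moves e M.toAutomaton lo hi w) t ∉ p.2) := by
    intro ρ hρ
    rw [isInitRun_determinize_iff hlo] at hρ
    simp only [← Set.not_nonempty_iff_eq_empty, infLoc_inter_nonempty_iff, not_frequently, hρ]
  constructor
  · rintro ⟨ρ, hρ, h⟩
    exact (key hρ).1 h
  · intro h
    have hρ := (isInitRun_determinize_iff (e := e) (M := M) hlo (w := w)).2 fun n => rfl
    exact ⟨_, hρ, (key hρ).2 h⟩

omit [Fintype A] in
theorem mem_lang_iff (hlo : lo ≤ hi) (hM : ∀ d ∈ M.consts, lo ≤ d ∧ d ≤ hi)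
    {w : ℕ → A × (Fin β → ℤ)} :
    w ∈ M.lang ↔ ∃ ρ : ℕ → V, ρ 0 ∈ e '' M.init ∧
      (∀ t, moves e M.toAutomaton lo hi w t (ρ t) (ρ (t + 1))) ∧
      ∃ᶠ t in atTop, ρ t ∈ e '' M.acc := by
  have := Finite.of_equiv V e.symm
  constructor
  · rintro ⟨ρ, hρ, h⟩
    rw [infLoc_inter_nonempty_iff] at h
    refine ⟨fun n => e (ρ n).src, Set.mem_image_of_mem _ hρ.init, fun t => ?_,
      h.mono fun n hn => Set.mem_image_of_mem _ hn⟩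
    exact (letterRel_typeOf_iff hlo hM).2
      ⟨ρ t, hρ.mem t, rfl, hρ.letter t, congrArg e (hρ.step t).symm, hρ.guard t⟩
  · rintro ⟨ρ, h0, hρ, hF⟩
    choose τ hτ hsrc hletter htgt hguard using fun t => (letterRel_typeOf_iff hlo hM).1 (hρ t)
    have hsrc' : ∀ t, (τ t).src = e.symm (ρ t) := fun t => by
      rw [← hsrc, Equiv.symm_apply_apply]
    refine ⟨τ, ⟨?_, hτ, hletter, fun n => ?_, hguard⟩, infLoc_inter_nonempty_iff.2 ?_⟩
    · obtain ⟨q, hq, h⟩ := h0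
      rwa [hsrc', ← h, Equiv.symm_apply_apply]
    · exact e.injective ((hsrc (n + 1)).trans (htgt n).symm)
    · refine hF.mono fun n hn => ?_
      obtain ⟨q, hq, h⟩ := hn
      rwa [hsrc', ← h, Equiv.symm_apply_apply]

end WordConstraint

theorem mainTheorem7 :
    ∃ c C : ℕ, ∀ (Q A : Type*) [Fintype Q] [Fintype A] (β : ℕ), 1 ≤ β →
      ∀ (M : WordConstraint.BuchiAutomaton Q A β)
        (α : ℕ) (d : Fin (α + 1) → ℤ), StrictMono d → M.consts ⊆ Set.range d →
      ∃ (Q' : Type) (_ : Fintype Q') (M' : WordConstraint.RabinAutomaton Q' A β),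
        (∃ q₀, M'.init = {q₀}) ∧
        M'.Deterministic ∧
        M'.lang = M.lang ∧
        -- `(n + 1) ^ (c * n)` is `2 ^ (c * n * log₂ (n + 1))`
        Fintype.card Q' ≤ (Fintype.card Q + 1) ^ (c * Fintype.card Q) ∧
        M'.pairs.card ≤ 2 * Fintype.card Q ∧
        (∀ τ ∈ M'.trans, τ.guard ∈ WordConstraint.SatTypes β (d 0) (d (Fin.last α))) ∧
        (∀ τ ∈ M'.trans, τ.guard.size ≤
          C * (β + max (Nat.clog 2 (d 0).natAbs) (Nat.clog 2 (d (Fin.last α)).natAbs)) ^ 3) ∧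
        (M'.trans.card : ℤ) ≤ (Fintype.card Q' : ℤ) ^ 2 * (Fintype.card A : ℤ) *
          ((d (Fin.last α) - d 0) + 3) ^ (2 * β) * 3 ^ (2 * β ^ 2) := by
  -- The exponent from `card_state_le` and the factor from `IsType.size_le`.
  refine ⟨4, 50, fun Q A _ _ β hβ M α d hd hM => ?_⟩
  have hlo : d 0 ≤ d (Fin.last α) := hd.monotone (Fin.zero_le _)
  have hconsts : ∀ c ∈ M.consts, d 0 ≤ c ∧ c ≤ d (Fin.last α) := fun c hc => by
    obtain ⟨i, rfl⟩ := hM hc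
    exact ⟨hd.monotone (Fin.zero_le _), hd.monotone (Fin.le_last _)⟩
  -- Numbering the locations puts the new state space in `Type`, whatever the universe of `Q`.
  have e : Q ≃ Fin (Fintype.card Q) := Fintype.equivFin Q
  have hcard := Safra.card_state_le (V := Fin (Fintype.card Q))
  have hpairs := Safra.card_pairs_le (V := Fin (Fintype.card Q))
  rw [Fintype.card_fin] at hpairs
  refine ⟨Safra.State (Fin (Fintype.card Q)), inferInstance,
    WordConstraint.determinize e M (d 0) (d (Fin.last α)), ⟨_, rfl⟩,
    WordConstraint.deterministic_determinize hlo, ?_, ?_, ?_, fun τ hτ => ?_, fun τ hτ => ?_,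
    WordConstraint.card_trans_determinize_le hlo⟩
  · ext w
    rw [WordConstraint.mem_lang_determinize_iff hlo,
      WordConstraint.mem_lang_iff (e := e) hlo hconsts, Safra.exists_run_iff]
  · simpa only [Fintype.card_fin] using hcard
  · exact hpairs.trans (Nat.le_mul_of_pos_left _ two_pos)
  · exact ((WordConstraint.mem_trans_determinize hlo).1 hτ).1
  · exact ((WordConstraint.mem_trans_determinize hlo).1 hτ).1.1.size_le hlo hβ
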